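/- Let $(M,Q)$ be a random vector with $\mathbb P(M\ge 0,\ Q\ge 0)=1$, and let $R$ be a perpetuity generated by $(M,Q)$, that is, $R$ is a random variable independent of $(M,Q)$ such that $R\stackrel{d}{=}MR+Q$. A positive function $g$, defined and measurable on a neighbourhood of $+\infty$, is regularly varying with index $\rho\in\mathbb R$ ($g\in\mathcal R_\rho$) if $g(tx)/g(x)\to t^\rho$ as $x\to\infty$ for every $t>0$. Assume that for some $\alpha,r>1$ $$x\mapsto-\log\mathbb P(Q>x)\in\mathcal R_\alpha,\qquad x\mapsto -x\log\mathbb P\left(M\ge 1-\tfrac1x\right)\in\mathcal R_r .$$ Let $\beta=\alpha/(\alpha-1)$ and $r^\ast=r/(r-1)$ be the conjugate numbers of $\alpha$ and $r$, put $\gamma=\beta r^\ast/(\beta r^\ast-1)$, and for $x>0$ let $$h_{ind}(x)=\inf_{t\ge1}\left\{-t\log\left[\mathbb P\left(M>1-\tfrac1t\right)\,\mathbb P\left(Q>\tfrac xt\right)\right]\right\}.$$ (i) If $(M,Q)$ is negatively quadrant dependent, i.e. $\mathbb P(M\le x,Q\le y)\le\mathbb P(M\le x)\mathbb P(Q\le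 y)$ for all $x,y\in\mathbb R$, then $$\limsup_{x\to\infty}\frac{\log\mathbb P(R>x)}{h_{ind}(x)}\le-\left(\frac{\gamma}{\gamma-1}\right)^{\gamma-1}.$$ (ii) If $(M,Q)$ is positively quadrant dependent, i.e. $\mathbb P(M\le x,Q\le y)\ge\mathbb P(M\le x)\mathbb P(Q\le y)$ for all $x,y\in\mathbb R$, then $$-\left(\frac{\gamma}{\gamma-1}\right)^{\gamma-1}\le\liminf_{x\to\infty}\frac{\log\mathbb P(R>x)}{h_{ind}(x)}\le\limsup_{x\to\infty}\frac{\log\mathbb P(R>x)}{h_{ind}(x)}\le-\frac{\alpha-1}{\alpha+r-1}\left(\frac{r}{\alpha-1}\right)^{r/(\alpha+r-1)}\left(\frac{\gamma}{\gamma-1}\right)^{\gamma-1}.$$ -/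

import Mathlib

open MeasureTheory ProbabilityTheory Filter Topology

namespace Perpetuity

/-- `L` is slowly varying at `+∞`: it is measurable and positive on some half-line `(X, ∞)`, and
`L (t x) / L x → 1` as `x → ∞` for every `t > 0`. -/
def IsSlowlyVarying (L : ℝ → ℝ) : Prop :=
  (∃ X : ℝ, Measurable (fun x : Set.Ioi X => L x) ∧ ∀ x > X, 0 < L x) ∧
    ∀ t : ℝ, 0 < t → Tendsto (fun x : ℝ => L (t * x) / L x) atTop (𝓝 1)

/-- `g` is regularly varying at `+∞` with index `ρ`: near `+∞` one has `g x = x ^ ρ * L x` with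
`L` slowly varying. -/
def IsRegularlyVarying (g : ℝ → ℝ) (ρ : ℝ) : Prop :=
  ∃ L : ℝ → ℝ, IsSlowlyVarying L ∧ ∀ᶠ x : ℝ in atTop, g x = x ^ ρ * L x

variable {Ω : Type*} [MeasurableSpace Ω]

/-- `R` is a perpetuity generated by `(M, Q)`: `R` is independent of `(M, Q)`, and `R` has the
same distribution as `M R + Q`. -/
def IsGeneratedBy (P : Measure Ω) (R M Q : Ω → ℝ) : Prop :=
  IndepFun R (fun ω => (M ω, Q ω)) P ∧
    IdentDistrib R (fun ω => M ω * R ω + Q ω) P P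

/-- Positive quadrant dependence of `(X, Y)`. -/
def PosQuadrantDependent (P : Measure Ω) (X Y : Ω → ℝ) : Prop :=
  ∀ x y : ℝ, P.real {ω | X ω ≤ x} * P.real {ω | Y ω ≤ y} ≤ P.real {ω | X ω ≤ x ∧ Y ω ≤ y}

/-- Negative quadrant dependence of `(X, Y)`. -/
def NegQuadrantDependent (P : Measure Ω) (X Y : Ω → ℝ) : Prop :=
  ∀ x y : ℝ, P.real {ω | X ω ≤ x ∧ Y ω ≤ y} ≤ P.real {ω | X ω ≤ x} * P.real {ω | Y ω ≤ y}

/-- The logarithmic tail `x ↦ - log P(X > x)`. -/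
noncomputable def logTail (P : Measure Ω) (X : Ω → ℝ) (x : ℝ) : ℝ :=
  -Real.log (P.real {ω | x < X ω})

/-- The function `h_ind(x) = inf_{t ≥ 1} { - t log [ P(1 / (1 - M) > t) P(Q > x / t) ] }`.
For `M < 1` the event `1 / (1 - M) > t` is the event `M > 1 - 1 / t`. The infimum is over
nonnegative numbers; if all the probabilities involved are positive (as they are when `P(Q > x)`
and `P(M ≥ 1 - 1 / x)` are positive for all large `x`), no logarithm of `0` occurs. -/
noncomputable def hInd (P : Measure Ω) (M Q : Ω → ℝ) (x : ℝ) : ℝ :=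
  sInf ((fun t : ℝ => t * logTail P M (1 - 1 / t) + t * logTail P Q (x / t)) '' Set.Ici 1)

/-- The quotient `log P(R > x) / h_ind(x)`, as an extended real number, so that its upper and lower
limits as `x → ∞` always exist. -/
noncomputable def tailRatio (P : Measure Ω) (R M Q : Ω → ℝ) (x : ℝ) : EReal :=
  ((Real.log (P.real {ω | x < R ω}) / hInd P M Q x : ℝ) : EReal)

end Perpetuity

/-!
The upper and lower bounds for the tail of the perpetuity `R` rest on one cost function. A step of
the recursion `R = M R + Q` with `M ≈ 1 - 1/t` and `Q ≈ q` moves the level `z` to `z - z/t + q`. With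
`φ(t) = -log P(M > 1 - 1/t)` and `k(q) = -log P(Q > q)`, the step costs `φ(t) + k(q)` in the
exponent if `M` and `Q` are independent. Hence `h = hInd`, `h(x) = inf t φ(t) + t k(x/t)`, measures
the cost of staying near the level `x`. It varies regularly with index `γ`
(`TailExponents.infCost_regVar`), since near-minimizers `t` tend to infinity together with `x/t`.

*Bound from below for `P(R > x)`.* Under positive quadrant dependence a step costs at most
`φ(t) + k(q)`. Repeating the step that is optimal for `(1 + δ) x`, `δ = 1/(γ - 1)`, carries `R` from
`x` to `l x`. Summation over a geometric sequence of levels and `l → 1` give the constant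
`(γ/(γ-1))^(γ-1)` (`TailExponents.exponent_le`).

*Bound from above.* Let `H` be a rate such that `-log P(M > 1 - 1/t, Q > q) ≳ H(q t)/t`
(`JointTailBound`). Let `Λ` be the cumulant generating function of `R`, which is convex. In
`E exp(z R) = E exp(z Q + Λ(z M))` convexity bounds `Λ(z M)` by `Λ(z)` minus a multiple `y` of
`1 - M`, where `y / z` is any slope of `Λ` to the left of `z`; thus `E exp(z Q - y (1 - M))`,
with `1 - M` truncated, is at least `1` (`mul_cgf_sub_le`). For `z = γ H(x)/x`, Young's inequality for
`H` shows that this moment tends to `0` if `y = b H(x)` with `b > γ - 1`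
(`JointTailBound.eventually_moment_lt_one`). So the slopes of `Λ` are controlled, and summing up,
`Λ(γ H(x)/x) ≲ (γ-1)²/γ · H(x)` (`JointTailBound.cgf_le`). Chernoff's inequality then yields
`-log P(R > x) ≳ (γ/(γ-1))^(γ-1) H(x)` (`JointTailBound.log_tail_le`).

Negative quadrant dependence permits `H = h`. In general the joint exponent is at least
`max (φ(t)) (k(q))`, and comparing the infimum of the maximum with that of the sum permits `H = κ h`
with the constant `κ` of the last bound (`TailExponents.mul_infCost_le_max`).
-/

namespace Perpetuity

/-! ### Regular variation without slowly varying factors -/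

/-- Regular variation of index `ρ` in ratio form: `g` is eventually positive and
`g (c x) / g x → c ^ ρ` for every `c > 0`. -/
structure RegVar (g : ℝ → ℝ) (ρ : ℝ) : Prop where
  pos : ∀ᶠ x in atTop, 0 < g x
  lim : ∀ c : ℝ, 0 < c → Tendsto (fun x => g (c * x) / g x) atTop (𝓝 (c ^ ρ))

lemma eventually_const_mul {p : ℝ → Prop} (h : ∀ᶠ x in atTop, p x) {c : ℝ} (hc : 0 < c) :
    ∀ᶠ x in atTop, p (c * x) :=
  (tendsto_id.const_mul_atTop hc).eventually h

lemma IsRegularlyVarying.regVar {g : ℝ → ℝ} {ρ : ℝ} (hg : IsRegularlyVarying g ρ) :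
    RegVar g ρ := by
  obtain ⟨L, ⟨⟨X, -, hX⟩, hL⟩, hgL⟩ := hg
  constructor
  · filter_upwards [hgL, eventually_gt_atTop X, eventually_gt_atTop 0] with x hx hx1 hx2
    rw [hx]
    exact mul_pos (Real.rpow_pos_of_pos hx2 _) (hX x hx1)
  · intro c hc
    have h1 : Tendsto (fun x => c ^ ρ * (L (c * x) / L x)) atTop (𝓝 (c ^ ρ)) := by
      simpa using (hL c hc).const_mul (c ^ ρ)
    refine h1.congr' ?_
    filter_upwards [hgL, eventually_const_mul hgL hc, eventually_gt_atTop 0] with x h2 h3 h4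
    have := Real.rpow_pos_of_pos h4 ρ
    rw [h2, h3, Real.mul_rpow hc.le h4.le]
    field_simp

namespace RegVar

variable {g : ℝ → ℝ} {ρ : ℝ}

lemma eventually_le_mul (hg : RegVar g ρ) {c b : ℝ} (hc : 0 < c) (hb : c ^ ρ < b) :
    ∀ᶠ x in atTop, g (c * x) ≤ b * g x := by
  filter_upwards [hg.pos, (hg.lim c hc).eventually_lt_const hb] with x h1 h2
  exact ((div_lt_iff₀ h1).1 h2).le

lemma eventually_mul_le (hg : RegVar g ρ) {c a : ℝ} (hc : 0 < c) (ha : a < c ^ ρ) :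
    ∀ᶠ x in atTop, a * g x ≤ g (c * x) := by
  filter_upwards [hg.pos, (hg.lim c hc).eventually_const_lt ha] with x h1 h2
  exact ((lt_div_iff₀ h1).1 h2).le

/-- Two-sided bounds for all factors `a < c ^ ρ < b` give back regular variation. -/
lemma of_bounds (hpos : ∀ᶠ x in atTop, 0 < g x)
    (hl : ∀ c : ℝ, 0 < c → ∀ a < c ^ ρ, ∀ᶠ x in atTop, a * g x ≤ g (c * x))
    (hu : ∀ c : ℝ, 0 < c → ∀ b > c ^ ρ, ∀ᶠ x in atTop, g (c * x) ≤ b * g x) : RegVar g ρ := by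
  refine ⟨hpos, fun c hc => tendsto_order.2 ⟨fun a ha => ?_, fun b hb => ?_⟩⟩
  · obtain ⟨a', h1, h2⟩ := exists_between ha
    filter_upwards [hpos, hl c hc a' h2] with x h3 h4
    rw [lt_div_iff₀ h3]
    nlinarith
  · obtain ⟨b', h1, h2⟩ := exists_between hb
    filter_upwards [hpos, hu c hc b' h1] with x h3 h4
    rw [div_lt_iff₀ h3]
    nlinarith

/-- For a regularly varying function the upper bounds suffice: the lower bound for the factor `c`
is the upper bound for `c⁻¹`. -/
lemma of_upper_bounds (hpos : ∀ᶠ x in atTop, 0 < g x)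
    (hu : ∀ c : ℝ, 0 < c → ∀ b > c ^ ρ, ∀ᶠ x in atTop, g (c * x) ≤ b * g x) : RegVar g ρ := by
  refine of_bounds hpos (fun c hc a ha => ?_) hu
  rcases le_or_gt a 0 with h0 | h0
  · filter_upwards [hpos, eventually_const_mul hpos hc] with x h1 h2
    nlinarith
  · have hb : c⁻¹ ^ ρ < a⁻¹ := by
      rw [Real.inv_rpow hc.le]
      exact inv_strictAnti₀ h0 ha
    filter_upwards [eventually_const_mul (hu c⁻¹ (inv_pos.2 hc) _ hb) hc] with x h1
    rw [inv_mul_cancel_left₀ hc.ne'] at h1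
    rwa [inv_mul_eq_div, le_div_iff₀ h0, mul_comm] at h1

lemma const_mul (hg : RegVar g ρ) {κ : ℝ} (hκ : 0 < κ) : RegVar (fun x => κ * g x) ρ := by
  refine ⟨hg.pos.mono fun x hx => mul_pos hκ hx, fun c hc => ?_⟩
  simpa only [mul_div_mul_left _ _ hκ.ne'] using hg.lim c hc

lemma id_mul (hg : RegVar g ρ) : RegVar (fun x => x * g x) (ρ + 1) := by
  constructor
  · filter_upwards [hg.pos, eventually_gt_atTop 0] with x h1 h2 using mul_pos h2 h1
  · intro c hc
    have := (hg.lim c hc).mul_const c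
    rw [Real.rpow_add_one hc.ne']
    refine this.congr' ?_
    filter_upwards [eventually_gt_atTop 0] with x hx
    field_simp

lemma of_id_mul (hg : RegVar (fun x => x * g x) ρ) : RegVar g (ρ - 1) := by
  constructor
  · filter_upwards [hg.pos, eventually_gt_atTop 0] with x h1 h2
    exact pos_of_mul_pos_right h1 h2.le
  · intro c hc
    have := (hg.lim c hc).div_const c
    rw [Real.rpow_sub_one hc.ne']
    refine this.congr' ?_
    filter_upwards [eventually_gt_atTop 0] with x hx
    field_simp

lemma tendsto_atTop (hg : RegVar g ρ) (hρ : 0 < ρ) (hmono : MonotoneOn g (Set.Ici 1)) :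
    Tendsto g atTop atTop := by
  obtain ⟨a, ha1, ha2⟩ := exists_between (Real.one_lt_rpow (by norm_num : (1 : ℝ) < 2) hρ)
  obtain ⟨X, hX⟩ := eventually_atTop.1
    ((hg.eventually_mul_le (by norm_num) ha2).and (hg.pos.and (eventually_ge_atTop 1)))
  have hX1 : 1 ≤ X := (hX X le_rfl).2.2
  have hgX := (hX X le_rfl).2.1
  have h2 : ∀ n : ℕ, X ≤ 2 ^ n * X := fun n =>
    le_mul_of_one_le_left (by linarith) (one_le_pow₀ (by norm_num))
  have key : ∀ n : ℕ, a ^ n * g X ≤ g (2 ^ n * X) := by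
    intro n
    induction n with
    | zero => simp
    | succ n ih =>
      have := (hX _ (h2 n)).1
      rw [pow_succ', pow_succ', mul_assoc, mul_assoc]
      nlinarith
  refine Filter.tendsto_atTop.2 fun b => ?_
  obtain ⟨n, hn⟩ := ((tendsto_pow_atTop_atTop_of_one_lt ha1).eventually
    (eventually_ge_atTop (b / g X))).exists
  filter_upwards [eventually_ge_atTop (2 ^ n * X)] with x hx
  rw [div_le_iff₀ hgX] at hn
  exact hn.trans ((key n).trans (hmono (hX1.trans (h2 n)) ((hX1.trans (h2 n)).trans hx) hx))

/-- Regular variation passes to a function squeezed between `g x` and `g (c x)`, for every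
`c > 1`. -/
lemma of_squeeze {u : ℝ → ℝ} (hg : RegVar g ρ) (hl : ∀ᶠ x in atTop, g x ≤ u x)
    (hu : ∀ c : ℝ, 1 < c → ∀ᶠ x in atTop, u x ≤ g (c * x)) : RegVar u ρ := by
  have hpos : ∀ᶠ x in atTop, 0 < u x := by
    filter_upwards [hg.pos, hl] with x h1 h2 using h1.trans_le h2
  refine of_upper_bounds hpos fun a ha b hb => ?_
  have hcont : Tendsto (fun c : ℝ => (c * a) ^ ρ) (𝓝[>] 1) (𝓝 (a ^ ρ)) := by
    have : ContinuousAt (fun c : ℝ => (c * a) ^ ρ) 1 :=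
      (continuousAt_id.mul continuousAt_const).rpow_const (Or.inl (by simpa using ha.ne'))
    simpa using this.tendsto.mono_left nhdsWithin_le_nhds
  obtain ⟨c, hc1, hc2⟩ :=
    ((hcont.eventually_lt_const hb).and self_mem_nhdsWithin).exists
  have hc : 1 < c := hc2
  filter_upwards [eventually_const_mul (hu c hc) ha, hl,
    hg.eventually_le_mul (mul_pos (by linarith) ha) hc1] with x h1 h2 h3
  rw [← mul_assoc] at h1
  have hb0 : 0 < b := (Real.rpow_pos_of_pos ha ρ).trans hb
  exact h1.trans (h3.trans (by gcongr))

end RegVar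

/-! ### Growth of a function with controlled increments over `[x, l x]` -/

/-- If `a (l x) - a x ≤ A (h (l x) - h x)` for large `x`, then `a ≤ A h + O(1)`: telescope along
`l ^ n y` with `y` in a bounded interval. -/
lemma le_of_increment_le {a h : ℝ → ℝ} {A l : ℝ} (hl : 1 < l)
    (hinc : ∀ᶠ x in atTop, a (l * x) - a x ≤ A * (h (l * x) - h x))
    (hbdd : ∀ᶠ x in atTop, ∃ C, ∀ y ∈ Set.Icc x (l * x), a y - A * h y ≤ C) :
    ∃ C, ∀ᶠ x in atTop, a x ≤ A * h x + C := by
  obtain ⟨X, hX⟩ := eventually_atTop.1 (hinc.and (hbdd.and (eventually_gt_atTop 0)))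
  have hX0 : 0 < X := (hX X le_rfl).2.2
  obtain ⟨C, hC⟩ := (hX X le_rfl).2.1
  have key : ∀ n : ℕ, ∀ y ∈ Set.Icc X (l * X), a (l ^ n * y) - A * h (l ^ n * y) ≤ C := by
    intro n
    induction n with
    | zero => simpa using hC
    | succ n ih =>
      intro y hy
      have h1 := (hX (l ^ n * y)
        (hy.1.trans (le_mul_of_one_le_left (hX0.le.trans hy.1) (one_le_pow₀ hl.le)))).1
      have h2 := ih y hy
      rw [pow_succ', mul_assoc]
      linarith
  refine ⟨C, ?_⟩
  filter_upwards [eventually_ge_atTop X] with x hx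
  obtain ⟨n, hn1, hn2⟩ := exists_nat_pow_near ((one_le_div hX0).2 hx) hl
  have hln : 0 < l ^ n := by positivity
  have h1 := key n (x / l ^ n) ⟨by
      rw [le_div_iff₀ hln]; rw [le_div_iff₀ hX0] at hn1; linarith, by
      rw [div_le_iff₀ hln]; rw [div_lt_iff₀ hX0, pow_succ] at hn2; nlinarith⟩
  rw [mul_div_cancel₀ x hln.ne'] at h1
  linarith

/-! ### The infimum of the cost `t φ(t) + t k(x / t)` -/

/-- The infimum over `t ≥ 1` of `t φ(t) + t k(x / t)`. With `φ(t) = -log P(M > 1 - 1/t)` and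
`k = -log P(Q > ·)` this is `hInd`. -/
noncomputable def infCost (φ k : ℝ → ℝ) (x : ℝ) : ℝ :=
  sInf ((fun t : ℝ => t * φ t + t * k (x / t)) '' Set.Ici 1)

/-- The properties of the two exponents `φ` and `k` on which the analysis of `infCost φ k` rests:
both are nonnegative and nondecreasing, and regularly varying of indices `r - 1` and `α`. -/
structure TailExponents (φ k : ℝ → ℝ) (r α : ℝ) : Prop where
  one_lt_r : 1 < r
  one_lt_α : 1 < α
  φ_nonneg : ∀ t, 1 ≤ t → 0 ≤ φ t
  φ_mono : MonotoneOn φ (Set.Ici 1)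
  φ_regVar : RegVar φ (r - 1)
  k_nonneg : ∀ x, 0 ≤ k x
  k_mono : Monotone k
  k_regVar : RegVar k α

namespace TailExponents

variable {φ k : ℝ → ℝ} {r α : ℝ}

lemma cost_nonneg (H : TailExponents φ k r α) {x t : ℝ} (ht : 1 ≤ t) :
    0 ≤ t * φ t + t * k (x / t) := by
  have := H.φ_nonneg t ht
  have := H.k_nonneg (x / t)
  positivity

lemma infCost_le (H : TailExponents φ k r α) (x : ℝ) {t : ℝ} (ht : 1 ≤ t) :
    infCost φ k x ≤ t * φ t + t * k (x / t) := by
  refine csInf_le ⟨0, ?_⟩ ⟨t, ht, rfl⟩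
  rintro _ ⟨s, hs, rfl⟩
  exact H.cost_nonneg hs

lemma le_infCost {x b : ℝ} (h : ∀ t, 1 ≤ t → b ≤ t * φ t + t * k (x / t)) :
    b ≤ infCost φ k x := by
  refine le_csInf (Set.nonempty_Ici.image _) ?_
  rintro _ ⟨s, hs, rfl⟩
  exact h s hs

lemma exists_cost_lt {x b : ℝ} (h : infCost φ k x < b) :
    ∃ t, 1 ≤ t ∧ t * φ t + t * k (x / t) < b := by
  obtain ⟨_, ⟨t, ht, rfl⟩, h2⟩ := exists_lt_of_csInf_lt (Set.nonempty_Ici.image _) h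
  exact ⟨t, ht, h2⟩

lemma infCost_nonneg (H : TailExponents φ k r α) (x : ℝ) : 0 ≤ infCost φ k x :=
  le_infCost fun _ ht => H.cost_nonneg ht

lemma infCost_mono (H : TailExponents φ k r α) : Monotone (infCost φ k) := by
  intro x y hxy
  refine le_infCost fun t ht => (H.infCost_le x ht).trans ?_
  have : k (x / t) ≤ k (y / t) := H.k_mono (by gcongr)
  gcongr

lemma tendsto_φ (H : TailExponents φ k r α) : Tendsto φ atTop atTop :=
  H.φ_regVar.tendsto_atTop (by linarith [H.one_lt_r]) H.φ_mono

lemma tendsto_k (H : TailExponents φ k r α) : Tendsto k atTop atTop :=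
  H.k_regVar.tendsto_atTop (by linarith [H.one_lt_α]) (H.k_mono.monotoneOn _)

lemma regVar_mul_φ (H : TailExponents φ k r α) : RegVar (fun t => t * φ t) r := by
  simpa using H.φ_regVar.id_mul

lemma exists_inv_rpow_lt {p : ℝ} (hp : 1 < p) {ε : ℝ} (hε : 0 < ε) :
    ∃ T : ℝ, 1 ≤ T ∧ T⁻¹ ^ p < ε / T := by
  have h1 : Tendsto (fun T : ℝ => T ^ (-(p - 1))) atTop (𝓝 0) :=
    tendsto_rpow_neg_atTop (by linarith)
  obtain ⟨T, h2, h3⟩ := ((h1.eventually_lt_const hε).and (eventually_ge_atTop 1)).exists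
  have hT : 0 < T := by linarith
  refine ⟨T, h3, ?_⟩
  rw [lt_div_iff₀ hT, Real.inv_rpow hT.le, ← Real.rpow_neg hT.le, ← Real.rpow_add_one hT.ne']
  convert h2 using 2
  ring

/-- The infimum is negligible with respect to `k`: compare with a large fixed `t`. -/
lemma infCost_le_mul_k (H : TailExponents φ k r α) {ε : ℝ} (hε : 0 < ε) :
    ∀ᶠ x in atTop, infCost φ k x ≤ ε * k x := by
  obtain ⟨T, hT1, hT⟩ := exists_inv_rpow_lt H.one_lt_α (half_pos hε)
  have hT0 : 0 < T := by linarith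
  filter_upwards [H.k_regVar.eventually_le_mul (inv_pos.2 hT0) hT,
    H.tendsto_k.eventually_ge_atTop (T * φ T / (ε / 2))] with x h1 h2
  have h3 := H.infCost_le x hT1
  rw [inv_mul_eq_div] at h1
  rw [div_le_iff₀ (half_pos hε)] at h2
  have h4 : T * k (x / T) ≤ T * (ε / 2 / T * k x) := by gcongr
  have h5 : T * (ε / 2 / T * k x) = ε / 2 * k x := by field_simp
  linarith

/-- The infimum is negligible with respect to `x φ(x)`: compare with `t = x / A` for a large fixed
`A`. -/
lemma infCost_le_mul_φ (H : TailExponents φ k r α) {ε : ℝ} (hε : 0 < ε) :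
    ∀ᶠ x in atTop, infCost φ k x ≤ ε * (x * φ x) := by
  obtain ⟨A, hA1, hA⟩ := exists_inv_rpow_lt H.one_lt_r (half_pos hε)
  have hA0 : 0 < A := by linarith
  filter_upwards [H.regVar_mul_φ.eventually_le_mul (inv_pos.2 hA0) hA,
    H.tendsto_φ.eventually_ge_atTop (k A / A / (ε / 2)), eventually_ge_atTop A,
    H.regVar_mul_φ.pos] with x h1 h2 hx hpos
  have hx0 : 0 < x := by linarith
  have h3 := H.infCost_le x ((one_le_div hA0).2 hx)
  rw [inv_mul_eq_div] at h1
  rw [div_le_iff₀ (half_pos hε)] at h2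
  rw [show x / (x / A) = A by field_simp] at h3
  have h4 : x / A * k A = x * (k A / A) := by ring
  have h5 : x * (k A / A) ≤ x * (φ x * (ε / 2)) := by gcongr
  have h6 : ε / 2 / A * (x * φ x) ≤ ε / 2 * (x * φ x) :=
    mul_le_mul_of_nonneg_right (div_le_self (by linarith) hA1) hpos.le
  linarith

/-- Near-minimizers `t` tend to infinity together with `x / t`: elsewhere the cost is of larger
order than the infimum. -/
lemma cost_large (H : TailExponents φ k r α) {C T A : ℝ} (hC : 0 < C) (hT : 1 ≤ T) (hA : 1 ≤ A) :
    ∀ᶠ x in atTop, ∀ t, 1 ≤ t → (t ≤ T → C * infCost φ k x ≤ t * k (x / t)) ∧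
      (x ≤ A * t → C * infCost φ k x ≤ t * φ t) := by
  have hT0 : 0 < T := by linarith
  have hA0 : 0 < A := by linarith
  have hT' : 0 < T⁻¹ ^ α := Real.rpow_pos_of_pos (inv_pos.2 hT0) _
  have hA' : 0 < A⁻¹ ^ r := Real.rpow_pos_of_pos (inv_pos.2 hA0) _
  filter_upwards [H.k_regVar.eventually_mul_le (inv_pos.2 hT0) (half_lt_self hT'),
    H.regVar_mul_φ.eventually_mul_le (inv_pos.2 hA0) (half_lt_self hA'),
    H.infCost_le_mul_k (div_pos (half_pos hT') hC), H.infCost_le_mul_φ (div_pos (half_pos hA') hC),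
    eventually_ge_atTop A] with x h1 h2 h3 h4 hx t ht
  have hx0 : 0 < x := by linarith
  have ht0 : 0 < t := by linarith
  rw [inv_mul_eq_div] at h1 h2
  rw [div_mul_eq_mul_div, le_div_iff₀ hC] at h3 h4
  refine ⟨fun h => ?_, fun h => ?_⟩
  · have h5 : k (x / T) ≤ k (x / t) := H.k_mono (by gcongr)
    have h6 := le_mul_of_one_le_left (H.k_nonneg (x / t)) ht
    linarith
  · have h7 : 1 ≤ x / A := (one_le_div hA0).2 hx
    have h8 : x / A ≤ t := by rwa [div_le_iff₀ hA0, mul_comm]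
    have h5 : φ (x / A) ≤ φ t := H.φ_mono h7 ht h8
    have h6 : x / A * φ (x / A) ≤ t * φ t := by
      have := H.φ_nonneg _ h7
      gcongr
    linarith

lemma infCost_pos (H : TailExponents φ k r α) : ∀ᶠ x in atTop, 0 < infCost φ k x := by
  obtain ⟨T, hT, hT1⟩ := ((H.tendsto_φ.eventually_ge_atTop 1).and (eventually_ge_atTop 1)).exists
  have hT0 : 0 < T := by linarith
  filter_upwards [(H.tendsto_k.comp (tendsto_id.atTop_div_const hT0)).eventually_ge_atTop 1,
    eventually_ge_atTop 0] with x hx hx0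
  refine one_pos.trans_le (le_infCost fun t ht => ?_)
  have ht0 : 0 < t := by linarith
  have h1 := H.φ_nonneg t ht
  have h2 := H.k_nonneg (x / t)
  rcases le_total T t with h | h
  · have h3 : φ T ≤ φ t := H.φ_mono hT1 ht h
    have : 0 ≤ t * k (x / t) := by positivity
    nlinarith
  · have h3 : k (x / T) ≤ k (x / t) := H.k_mono (by gcongr)
    have h4 : (1 : ℝ) ≤ k (x / T) := hx
    have : 0 ≤ t * φ t := by positivity
    nlinarith

/-- Near-minimizers exist beyond any `T`. -/
lemma exists_near_minimizer (H : TailExponents φ k r α) {b T A : ℝ} (hb : 1 < b) (hT : 1 ≤ T)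
    (hA : 1 ≤ A) :
    ∀ᶠ x in atTop, ∃ t, T ≤ t ∧ A * t ≤ x ∧ t * φ t + t * k (x / t) ≤ b * infCost φ k x := by
  filter_upwards [H.cost_large (by linarith : 0 < b) hT hA, H.infCost_pos] with x h1 h2
  obtain ⟨t, ht, h3⟩ := exists_cost_lt (lt_mul_of_one_lt_left h2 hb)
  have ht0 : 0 < t := by linarith
  have h4 : 0 ≤ t * φ t := mul_nonneg ht0.le (H.φ_nonneg t ht)
  have h5 : 0 ≤ t * k (x / t) := mul_nonneg ht0.le (H.k_nonneg _)
  refine ⟨t, ?_, ?_, h3.le⟩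
  · by_contra! h
    linarith [(h1 t ht).1 h.le]
  · by_contra! h
    linarith [(h1 t ht).2 h.le]

/-- The infimum varies regularly: a near-minimizer `t` for `x`, multiplied by
`c ^ (α / (α + r - 1))`, is a near-minimizer for `c x`. -/
lemma infCost_regVar (H : TailExponents φ k r α) :
    RegVar (infCost φ k) (α * r / (α + r - 1)) := by
  have hr := H.one_lt_r
  have hα := H.one_lt_α
  have hd : 0 < α + r - 1 := by linarith
  refine RegVar.of_upper_bounds H.infCost_pos fun c hc b hb => ?_
  set γ := α * r / (α + r - 1) with hγ
  set s := α / (α + r - 1) with hs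
  set u := c ^ s with hu
  set v := c ^ (1 - s) with hv
  have hu0 : 0 < u := Real.rpow_pos_of_pos hc _
  have hv0 : 0 < v := Real.rpow_pos_of_pos hc _
  have huv : u * v = c := by rw [hu, hv, ← Real.rpow_add hc]; simp
  have hur : u ^ r = c ^ γ := by
    rw [hu, ← Real.rpow_mul hc.le, hs, hγ]; congr 1; ring
  have huva : u * v ^ α = c ^ γ := by
    rw [hu, hv, ← Real.rpow_mul hc.le, ← Real.rpow_add hc, hs, hγ]
    congr 1
    field_simp
    ring
  have hc0 : 0 < c ^ γ := Real.rpow_pos_of_pos hc _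
  obtain ⟨b₁, hb₁, hb₂⟩ := exists_between hb
  have hb10 : 0 < b₁ := hc0.trans hb₁
  obtain ⟨T, hT⟩ := eventually_atTop.1 (H.regVar_mul_φ.eventually_le_mul hu0 (hur.trans_lt hb₁))
  obtain ⟨A, hA⟩ := eventually_atTop.1 (H.k_regVar.eventually_le_mul (b := b₁ / u) hv0
    (by rw [lt_div_iff₀ hu0, mul_comm]; exact huva.trans_lt hb₁))
  filter_upwards [H.exists_near_minimizer ((one_lt_div hb10).2 hb₂)
    (le_max_right (max T u⁻¹) 1) (le_max_right A 1), eventually_gt_atTop 0] with x h1 hx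
  obtain ⟨t, ht, hAt, hcost⟩ := h1
  have ht1 : 1 ≤ t := (le_max_right _ _).trans ht
  have ht0 : 0 < t := by linarith
  have htT : T ≤ t := ((le_max_left _ _).trans (le_max_left _ _)).trans ht
  have htu : 1 ≤ u * t := by
    have : u⁻¹ ≤ t := ((le_max_right _ _).trans (le_max_left _ _)).trans ht
    rwa [inv_le_iff_one_le_mul₀' hu0] at this
  have hxA : A ≤ x / t := by
    rw [le_div_iff₀ ht0]
    exact (mul_le_mul_of_nonneg_right (le_max_left _ _) ht0.le).trans hAt
  have h3 := hT t htT
  have h4 := hA _ hxA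
  have h5 := H.infCost_le (c * x) htu
  rw [show c * x / (u * t) = v * (x / t) by rw [← huv]; field_simp] at h5
  have h6 : u * t * k (v * (x / t)) ≤ u * t * (b₁ / u * k (x / t)) := by gcongr
  have h7 : u * t * (b₁ / u * k (x / t)) = b₁ * (t * k (x / t)) := by field_simp
  have h8 : b₁ * (t * φ t + t * k (x / t)) ≤ b₁ * (b / b₁ * infCost φ k x) := by gcongr
  have h9 : b₁ * (b / b₁ * infCost φ k x) = b * infCost φ k x := by field_simp
  linarith

/-- Replacing the sum `φ(t) + k(x / t)` by the maximum costs at most the factor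
`u ^ r + u ^ (1 - α)`, for any `u > 0`: compare the infimum with the cost at `u t`. -/
lemma mul_infCost_le_max (H : TailExponents φ k r α) {u κ : ℝ} (hu : 0 < u) (hκ : 0 < κ)
    (hκu : κ * (u ^ r + u ^ (1 - α)) < 1) :
    ∀ᶠ x in atTop, ∀ t, 1 ≤ t → κ * infCost φ k x ≤ max (t * φ t) (t * k (x / t)) := by
  have h0 : u ^ (1 - α) = u * u⁻¹ ^ α := by
    rw [Real.inv_rpow hu.le, ← Real.rpow_neg hu.le, ← Real.rpow_one_add' hu.le]
    · rw [sub_eq_add_neg]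
    · linarith [H.one_lt_α]
  -- `η` splits the available room between the two terms
  set η := (1 / κ - (u ^ r + u ^ (1 - α))) / 2 with hη
  have hη0 : 0 < η := by
    have : u ^ r + u ^ (1 - α) < 1 / κ := by rw [lt_div_iff₀ hκ]; linarith
    linarith
  obtain ⟨T, hT⟩ := eventually_atTop.1
    (H.regVar_mul_φ.eventually_le_mul hu (lt_add_of_pos_right (u ^ r) hη0))
  obtain ⟨A, hA⟩ := eventually_atTop.1 (H.k_regVar.eventually_le_mul (b := u⁻¹ ^ α + η / u)
    (inv_pos.2 hu) (lt_add_of_pos_right _ (by positivity)))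
  filter_upwards [H.cost_large hκ (le_max_right (max T u⁻¹) 1) (le_max_right A 1)] with x h1 t ht
  have ht0 : 0 < t := by linarith
  rcases le_total t (max (max T u⁻¹) 1) with h2 | h2
  · exact ((h1 t ht).1 h2).trans (le_max_right _ _)
  rcases le_total x (max A 1 * t) with h3 | h3
  · exact ((h1 t ht).2 h3).trans (le_max_left _ _)
  have htT : T ≤ t := ((le_max_left _ _).trans (le_max_left _ _)).trans h2
  have htu : 1 ≤ u * t := by
    have : u⁻¹ ≤ t := ((le_max_right _ _).trans (le_max_left _ _)).trans h2
    rwa [inv_le_iff_one_le_mul₀' hu] at this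
  have hxA : A ≤ x / t := by
    rw [le_div_iff₀ ht0]
    exact (mul_le_mul_of_nonneg_right (le_max_left _ _) ht0.le).trans h3
  have h4 := hT t htT
  have h5 := hA _ hxA
  have h6 := H.infCost_le x htu
  rw [show x / (u * t) = u⁻¹ * (x / t) by field_simp] at h6
  have h7 : u * t * k (u⁻¹ * (x / t)) ≤ u * t * ((u⁻¹ ^ α + η / u) * k (x / t)) := by gcongr
  have h8 : u * t * ((u⁻¹ ^ α + η / u) * k (x / t)) =
      (u ^ (1 - α) + η) * (t * k (x / t)) := by
    rw [h0]; field_simp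
  set m := max (t * φ t) (t * k (x / t))
  have hur : 0 < u ^ r := Real.rpow_pos_of_pos hu _
  have hua : 0 < u ^ (1 - α) := Real.rpow_pos_of_pos hu _
  have h9 : (u ^ r + η) * (t * φ t) ≤ (u ^ r + η) * m := by
    gcongr
    exact le_max_left _ _
  have h10 : (u ^ (1 - α) + η) * (t * k (x / t)) ≤ (u ^ (1 - α) + η) * m := by
    gcongr
    exact le_max_right _ _
  have h11 : infCost φ k x ≤ 1 / κ * m := by
    have : (u ^ r + η) * m + (u ^ (1 - α) + η) * m = 1 / κ * m := by rw [hη]; ring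
    linarith
  calc κ * infCost φ k x ≤ κ * (1 / κ * m) := by gcongr
    _ = m := by field_simp

end TailExponents

/-! ### Upper bound for the exponent of `R` -/

lemma exists_one_lt_mul_rpow_lt {K A : ℝ} (h : K < A) (p : ℝ) :
    ∃ l : ℝ, 1 < l ∧ K * l ^ p < A := by
  have hcont : Tendsto (fun l : ℝ => K * l ^ p) (𝓝[>] 1) (𝓝 K) := by
    have : ContinuousAt (fun l : ℝ => K * l ^ p) 1 :=
      continuousAt_const.mul (continuousAt_id.rpow_const (Or.inl one_ne_zero))
    simpa using this.tendsto.mono_left nhdsWithin_le_nhds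
  obtain ⟨l, h1, h2⟩ := ((hcont.eventually_lt_const h).and self_mem_nhdsWithin).exists
  exact ⟨l, h2, h1⟩

lemma tangent_rpow {γ v : ℝ} (hγ : 1 ≤ γ) (hv : 0 ≤ v) : γ * v - v ^ γ ≤ γ - 1 := by
  have := one_add_mul_self_le_rpow_one_add (by linarith : -1 ≤ v - 1) hγ
  rw [add_sub_cancel] at this
  linarith

namespace TailExponents

variable {φ k : ℝ → ℝ} {r α : ℝ}

lemma one_lt_index (H : TailExponents φ k r α) : 1 < α * r / (α + r - 1) := by
  have hr := H.one_lt_r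
  have hα := H.one_lt_α
  rw [one_lt_div (by linarith)]
  nlinarith

lemma tendsto_infCost (H : TailExponents φ k r α) : Tendsto (infCost φ k) atTop atTop :=
  H.infCost_regVar.tendsto_atTop (by linarith [H.one_lt_index]) (H.infCost_mono.monotoneOn _)

/-- Steps with the same `t` and `q = y / t`, `y > l x`, lead from `x` to `l x`: each gains at least
`(y - l x) / t`. -/
lemma le_add_of_steps {G : ℝ → ℝ} (hG : Monotone G)
    (hstep : ∀ z t q, 0 ≤ z → 1 ≤ t → 0 ≤ q → G (z - z / t + q) ≤ G z + (φ t + k q))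
    {x y t l : ℝ} (hx : 0 ≤ x) (hl : 1 ≤ l) (ht : 1 ≤ t) (hy : l * x ≤ y) (n : ℕ) :
    G (min (l * x) (x + n * ((y - l * x) / t))) ≤ G x + n * (φ t + k (y / t)) := by
  have ht0 : 0 < t := by linarith
  have hxl : x ≤ l * x := le_mul_of_one_le_left hx hl
  have hd : 0 ≤ (y - l * x) / t := div_nonneg (by linarith) ht0.le
  induction n with
  | zero => simp [min_eq_right hxl]
  | succ n ih =>
    set z := min (l * x) (x + n * ((y - l * x) / t)) with hz
    have hz0 : 0 ≤ z := le_min (hx.trans hxl) (by positivity)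
    have h1 := hstep z t (y / t) hz0 ht (div_nonneg (hx.trans (hxl.trans hy)) ht0.le)
    have h2 : z + (y - l * x) / t ≤ z - z / t + y / t := by
      have : z / t ≤ l * x / t := by
        gcongr
        exact min_le_left _ _
      rw [sub_div]
      linarith
    have h3 : min (l * x) (x + (n + 1 : ℕ) * ((y - l * x) / t)) ≤ z + (y - l * x) / t := by
      rw [hz, min_add]
      push_cast
      refine min_le_min (by linarith) (by linarith)
    have h4 := hG (h3.trans h2)
    push_cast at h4 ⊢
    linarith

/-- If one step of the recursion from level `z` with parameters `(t, q)` costs at most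
`φ(t) + k(q)`, then the exponent `G` of `R` is at most `(γ / (γ - 1)) ^ (γ - 1)` times the
infimum, asymptotically. On `[x, l x]` one uses a near-minimizer for `(1 + δ) l x` with the optimal
surplus `δ = 1 / (γ - 1)`, and then lets `l` decrease to `1`. -/
theorem exponent_le (H : TailExponents φ k r α) {γ : ℝ} (hγ : γ = α * r / (α + r - 1))
    {G : ℝ → ℝ} (hG : Monotone G)
    (hstep : ∀ z t q, 0 ≤ z → 1 ≤ t → 0 ≤ q → G (z - z / t + q) ≤ G z + (φ t + k q))
    {A : ℝ} (hA : (γ / (γ - 1)) ^ (γ - 1) < A) :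
    ∀ᶠ x in atTop, G x ≤ A * infCost φ k x := by
  have hγ1 : 1 < γ := hγ ▸ H.one_lt_index
  have hreg : RegVar (infCost φ k) γ := hγ ▸ H.infCost_regVar
  have hγ0 : 0 < γ - 1 := by linarith
  obtain ⟨A₀, hA₀, hA₀A⟩ := exists_between hA
  set h := infCost φ k with hh
  set δ := 1 / (γ - 1) with hδ
  have hδ0 : 0 < δ := by positivity
  have h1δ : 1 + δ = γ / (γ - 1) := by rw [hδ]; field_simp; ring
  obtain ⟨l, hl1, hl⟩ := exists_one_lt_mul_rpow_lt hA₀ (γ - 1)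
  have hl0 : 0 < l := by linarith
  have hK0 : 0 < (γ / (γ - 1)) ^ (γ - 1) := by positivity
  have hA0 : 0 < A₀ := hK0.trans hA₀
  set D := ((1 + δ) * l) ^ γ with hD
  set m := (l - 1) / (δ * l) with hm
  have hD0 : 0 < D := by positivity
  have hm0 : 0 < m := div_pos (by linarith) (by positivity)
  have hDm : D * m = ((γ / (γ - 1)) ^ (γ - 1) * l ^ (γ - 1)) * (γ * (l - 1)) := by
    have e1 : D = (γ / (γ - 1)) ^ (γ - 1) * (γ / (γ - 1)) * (l ^ (γ - 1) * l) := by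
      rw [hD, h1δ, Real.mul_rpow (by positivity) hl0.le, ← Real.rpow_add_one (by positivity),
        ← Real.rpow_add_one hl0.ne', sub_add_cancel]
    rw [e1, hm, hδ]
    field_simp
  have hbern : γ * (l - 1) ≤ l ^ γ - 1 := by
    have := one_add_mul_self_le_rpow_one_add (by linarith : -1 ≤ l - 1) hγ1.le
    rw [add_sub_cancel] at this
    linarith
  have hDE : D * m < A₀ * (l ^ γ - 1) := by
    rw [hDm]
    have : 0 < γ * (l - 1) := mul_pos (by linarith) (by linarith)
    nlinarith
  -- room for the errors: `D m < D m' < P m' = E' < A₀ (l ^ γ - 1)`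
  obtain ⟨E', hE1, hE2⟩ := exists_between hDE
  obtain ⟨m', hm1, hm2⟩ := exists_between ((lt_div_iff₀' hD0).2 hE1)
  have hm'0 : 0 < m' := hm0.trans hm1
  obtain ⟨B, hB1, hB2⟩ := exists_between
    ((lt_div_iff₀ hm'0).2 ((lt_div_iff₀' hD0).1 hm2) : D < E' / m')
  have hB0 : 0 < B := hD0.trans hB1
  have hinc : ∀ᶠ x in atTop, G (l * x) - G x ≤ A₀ * (h (l * x) - h x) := by
    filter_upwards [eventually_const_mul (H.exists_near_minimizer ((one_lt_div hB0).2 hB2)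
        (le_max_left 1 (m' - m)⁻¹) le_rfl) (mul_pos (by linarith : 0 < 1 + δ) hl0),
      hreg.eventually_le_mul (mul_pos (by linarith : 0 < 1 + δ) hl0) hB1,
      hreg.eventually_mul_le hl0 (a := 1 + E' / A₀) (by
        have : E' / A₀ < l ^ γ - 1 := by rw [div_lt_iff₀' hA0]; exact hE2
        linarith), eventually_gt_atTop 0] with x hx hx2 hx3 hx0
    obtain ⟨t, ht, -, hcost⟩ := hx
    have ht1 : 1 ≤ t := (le_max_left _ _).trans ht
    have ht0 : 0 < t := by linarith
    have hy : (1 + δ) * l * x - l * x = δ * l * x := by ring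
    have hstep' := le_add_of_steps hG hstep (y := (1 + δ) * l * x) hx0.le hl1.le ht1
      (by have : 0 < δ * l * x := by positivity
          linarith) ⌈m * t⌉₊
    have hn1 := Nat.le_ceil (m * t)
    have hn2 := (Nat.ceil_lt_add_one (mul_nonneg hm0.le ht0.le)).le
    set n : ℝ := (⌈m * t⌉₊ : ℝ) with hn
    have hreach : l * x ≤ x + n * (((1 + δ) * l * x - l * x) / t) := by
      have : m * t * (δ * l * x / t) = (l - 1) * x := by rw [hm]; field_simp
      have h2 : m * t * (δ * l * x / t) ≤ n * (δ * l * x / t) := by gcongr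
      rw [hy]
      linarith
    rw [min_eq_left hreach] at hstep'
    set c := φ t + k ((1 + δ) * l * x / t) with hc
    have htc : t * c ≤ E' / m' / B * (B * h x) := by
      refine le_trans ?_ (mul_le_mul_of_nonneg_left hx2 (by
        have := hE1; have : 0 < E' := by nlinarith
        positivity))
      rw [hc, mul_add]
      exact hcost
    have hmt : n ≤ m' * t := by
      have : (m' - m)⁻¹ ≤ t := (le_max_right _ _).trans ht
      rw [inv_le_iff_one_le_mul₀' (by linarith)] at this
      linarith
    have hc0 : 0 ≤ c := add_nonneg (H.φ_nonneg t ht1) (H.k_nonneg _)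
    have h5 : n * c ≤ E' * h x := by
      calc n * c ≤ m' * t * c := by gcongr
        _ = m' * (t * c) := by ring
        _ ≤ m' * (E' / m' / B * (B * h x)) := by gcongr
        _ = E' * h x := by field_simp
    have h6 : A₀ * ((1 + E' / A₀) * h x) = A₀ * h x + E' * h x := by field_simp
    have h7 := mul_le_mul_of_nonneg_left hx3 hA0.le
    linarith
  obtain ⟨C, hC⟩ := le_of_increment_le hl1 hinc (Eventually.of_forall fun x =>
    ⟨G (l * x), fun y hy => by
      have := hG hy.2
      have := mul_nonneg hA0.le (H.infCost_nonneg y)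
      linarith⟩)
  filter_upwards [hC, H.tendsto_infCost.eventually_ge_atTop (C / (A - A₀))] with x h1 h2
  rw [div_le_iff₀ (by linarith)] at h2
  linarith

end TailExponents

/-! ### Young's inequality for a regularly varying function -/

lemma exists_young_const {γ : ℝ} (hγ : 1 < γ) {p : ℝ} (hp : 0 < p) :
    ∃ q, 0 < q ∧ ∀ v, 0 ≤ v → p * v - v ^ γ ≤ q := by
  refine ⟨p * p ^ (1 / (γ - 1)), by positivity, fun v hv => ?_⟩
  rcases le_total v (p ^ (1 / (γ - 1))) with h | h
  · have := Real.rpow_nonneg hv γ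
    nlinarith
  · have h1 : p ≤ v ^ (γ - 1) := by
      have := Real.rpow_le_rpow (by positivity) h (by linarith : 0 ≤ γ - 1)
      rwa [← Real.rpow_mul hp.le, one_div_mul_cancel (by linarith), Real.rpow_one] at this
    have h2 : v ^ γ = v ^ (γ - 1) * v := by
      rw [← Real.rpow_add_one' hv (by linarith), sub_add_cancel]
    have : 0 < p * p ^ (1 / (γ - 1)) := by positivity
    nlinarith

/-- The inequality `γ v - v ^ γ ≤ γ - 1`, rescaled. -/
lemma young_scaled {γ c v : ℝ} (hγ : 1 < γ) (hc : 0 < c) (hv : 0 ≤ v) :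
    γ * c ^ (γ - 1) * v - v ^ γ ≤ (γ - 1) * c ^ γ := by
  have h := tangent_rpow hγ.le (div_nonneg hv hc.le)
  have hcγ : 0 < c ^ γ := Real.rpow_pos_of_pos hc _
  rw [Real.div_rpow hv hc.le] at h
  have h2 := mul_le_mul_of_nonneg_right h hcγ.le
  have h3 : (γ * (v / c) - v ^ γ / c ^ γ) * c ^ γ = γ * c ^ (γ - 1) * v - v ^ γ := by
    rw [Real.rpow_sub_one hc.ne']
    field_simp
  linarith

namespace RegVar

variable {h : ℝ → ℝ} {γ : ℝ}

/-- A regularly varying function of index `γ > 1` is eventually superlinear, uniformly. -/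
lemma superlinear (hh : RegVar h γ) (hγ : 1 < γ) (hmono : Monotone h) {p : ℝ} (hp : 0 < p) :
    ∃ V, 1 ≤ V ∧ ∀ᶠ x in atTop, ∀ v, V ≤ v → p * v * h x ≤ h (v * x) := by
  have h2γ : (2 : ℝ) < 2 ^ γ := by
    simpa using Real.rpow_lt_rpow_of_exponent_lt (by norm_num : (1 : ℝ) < 2) hγ
  obtain ⟨a, ha1, ha2⟩ := exists_between h2γ
  obtain ⟨N, hN⟩ := ((tendsto_pow_atTop_atTop_of_one_lt
    ((one_lt_div (by norm_num : (0 : ℝ) < 2)).2 ha1)).eventually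
    (eventually_ge_atTop (2 * p))).exists
  refine ⟨2 ^ N, one_le_pow₀ (by norm_num), ?_⟩
  obtain ⟨X, hX⟩ := eventually_atTop.1
    ((hh.eventually_mul_le (by norm_num) ha2).and (hh.pos.and (eventually_gt_atTop 0)))
  filter_upwards [eventually_ge_atTop X] with x hx v hv
  have hx0 := (hX x hx).2.2
  have hhx := (hX x hx).2.1
  have key : ∀ n : ℕ, a ^ n * h x ≤ h (2 ^ n * x) := by
    intro n
    induction n with
    | zero => simp
    | succ n ih =>
      have := (hX (2 ^ n * x) (hx.trans (le_mul_of_one_le_left hx0.le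
        (one_le_pow₀ (by norm_num))))).1
      rw [pow_succ', pow_succ', mul_assoc, mul_assoc]
      nlinarith
  have hv1 : 1 ≤ v := (one_le_pow₀ (by norm_num)).trans hv
  obtain ⟨n, hn1, hn2⟩ := exists_nat_pow_near hv1 (by norm_num : (1 : ℝ) < 2)
  have hNn : N ≤ n := by
    by_contra! hlt
    have : (2 : ℝ) ^ (n + 1) ≤ 2 ^ N := pow_le_pow_right₀ (by norm_num) hlt
    linarith
  have h3 : 2 * p ≤ (a / 2) ^ n :=
    hN.trans (pow_le_pow_right₀ ((one_lt_div (by norm_num : (0 : ℝ) < 2)).2 ha1).le hNn)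
  rw [div_pow, le_div_iff₀ (by positivity)] at h3
  have h4 : p * v ≤ a ^ n := by
    have : p * v ≤ p * 2 ^ (n + 1) := by gcongr
    rw [pow_succ] at this
    linarith
  calc p * v * h x ≤ a ^ n * h x := by gcongr
    _ ≤ h (2 ^ n * x) := key n
    _ ≤ h (v * x) := hmono (by gcongr)

/-- If `p v ≤ v ^ γ + q₀` for all `v ≥ 0` and `q > q₀`, then `p v h(x) ≤ h(v x) + q h(x)` for all
large `x`, uniformly in `v = u / x ≥ 0`: an asymptotic form of Young's inequality. -/
lemma young (hh : RegVar h γ) (hγ : 1 < γ) (hmono : Monotone h) (h0 : ∀ x, 0 ≤ h x)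
    {p q₀ q : ℝ} (hp : 0 < p) (hpq : ∀ v, 0 ≤ v → p * v - v ^ γ ≤ q₀) (hq : q₀ < q) :
    ∀ᶠ x in atTop, ∀ u, 0 ≤ u → p * (u / x) * h x ≤ h u + q * h x := by
  obtain ⟨V, hV1, hV⟩ := hh.superlinear hγ hmono hp
  have hq0 : 0 ≤ q₀ := by simpa [Real.zero_rpow (by linarith : γ ≠ 0)] using hpq 0 le_rfl
  set σ := (q - q₀) / 2 / p with hσ
  have hσ0 : 0 < σ := by have := sub_pos.2 hq; positivity
  -- below `V` the mesh `i σ` suffices, by monotonicity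
  have hgrid : ∀ᶠ x in atTop, ∀ i ∈ Finset.range (⌊V / σ⌋₊ + 1),
      ((i * σ) ^ γ - (q - q₀) / 2) * h x ≤ h (i * σ * x) := by
    rw [eventually_all_finset]
    intro i _
    rcases Nat.eq_zero_or_pos i with rfl | hi
    · filter_upwards with x
      have h1 := h0 x
      have h2 := h0 (((0 : ℕ) : ℝ) * σ * x)
      rw [Nat.cast_zero, zero_mul, Real.zero_rpow (by linarith)]
      rw [Nat.cast_zero, zero_mul] at h2
      nlinarith
    · have : (0 : ℝ) < i := by exact_mod_cast hi
      exact hh.eventually_mul_le (by positivity) (by linarith)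
  filter_upwards [hV, hgrid, eventually_gt_atTop 0] with x h1 h2 hx u hu
  have hux : u / x * x = u := div_mul_cancel₀ _ hx.ne'
  have hv0 : 0 ≤ u / x := by positivity
  set v := u / x with hv
  have hhx := h0 x
  rcases le_total V v with h3 | h3
  · have := h1 v h3
    rw [hux] at this
    nlinarith
  · have hi1 := Nat.floor_le (div_nonneg hv0 hσ0.le)
    have hi2 := Nat.lt_floor_add_one (v / σ)
    rw [le_div_iff₀ hσ0] at hi1
    rw [div_lt_iff₀ hσ0] at hi2
    have h4 := h2 ⌊v / σ⌋₊ (Finset.mem_range.2 (Nat.lt_succ_of_le (by gcongr)))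
    set i : ℝ := (⌊v / σ⌋₊ : ℝ) with hi
    have h5 := hpq (i * σ) (by positivity)
    have h6 : h (i * σ * x) ≤ h u := hmono (by rw [← hux]; gcongr)
    have h7 : p * v ≤ p * (i * σ) + (q - q₀) / 2 := by
      have : p * v ≤ p * ((i + 1) * σ) := by gcongr
      have e : p * ((i + 1) * σ) = p * (i * σ) + (q - q₀) / 2 := by rw [hσ]; field_simp
      linarith
    have h8 : p * v * h x ≤ ((i * σ) ^ γ - (q - q₀) / 2 + q) * h x := by
      refine mul_le_mul_of_nonneg_right ?_ hhx
      linarith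
    linarith

/-- A form of `RegVar.young` that tolerates a factor `1 - ε` and an additive constant. -/
lemma young_perturbed (hh : RegVar h γ) (hγ : 1 < γ) (hmono : Monotone h) (h0 : ∀ x, 0 ≤ h x)
    {p p' q₀ q : ℝ} (hp' : 0 < p') (hpp : p' < p) (hpq : ∀ v, 0 ≤ v → p * v - v ^ γ ≤ q₀)
    (hq : q₀ < q) :
    ∃ ε, 0 < ε ∧ ε < 1 ∧ ∀ C, ∀ᶠ x in atTop, ∀ u, 0 ≤ u →
      p' * (u / x) * h x - q * h x ≤ (1 - ε) * h u - C := by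
  have hp : 0 < p := hp'.trans hpp
  have hpp0 : 0 < p' / p := by positivity
  have hpp1 : p' / p < 1 := (div_lt_one hp).2 hpp
  refine ⟨1 - p' / p, by linarith, by linarith, fun C => ?_⟩
  have hq0 : 0 ≤ q₀ := by simpa [Real.zero_rpow (by linarith : γ ≠ 0)] using hpq 0 le_rfl
  obtain ⟨q₁, hq1, hq2⟩ := exists_between hq
  filter_upwards [hh.young hγ hmono h0 hp hpq hq1,
    (hh.tendsto_atTop (by linarith) (hmono.monotoneOn _)).eventually_ge_atTop (C / (q - q₁))]
    with x h1 h2 u hu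
  rw [div_le_iff₀ (by linarith)] at h2
  have h3 := mul_le_mul_of_nonneg_left (h1 u hu) hpp0.le
  have h4 : p' / p * (p * (u / x) * h x) = p' * (u / x) * h x := by field_simp
  have h5 : p' / p * (q₁ * h x) ≤ q₁ * h x :=
    mul_le_of_le_one_left (mul_nonneg (by linarith) (h0 x)) hpp1.le
  rw [sub_sub_cancel]
  linarith

end RegVar

/-! ### Exponential moments -/

section ExponentialMoments

variable {Ω : Type*} [MeasurableSpace Ω] {P : Measure Ω}

lemma ofReal_exp_add (a b : ℝ) :
    ENNReal.ofReal (Real.exp (a + b)) =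
      ENNReal.ofReal (Real.exp a) * ENNReal.ofReal (Real.exp b) := by
  rw [Real.exp_add, ENNReal.ofReal_mul (Real.exp_pos _).le]

/-- Exponential moment on an event `A` from exponential tail bounds on `A`, by the layer cake
formula. -/
lemma setLIntegral_exp_le {Q : Ω → ℝ} (hQ : Measurable Q) (hQ0 : ∀ᵐ ω ∂P, 0 ≤ Q ω)
    {A : Set Ω} {z s a : ℝ} (hz : 0 < z) (hs : 0 < s)
    (hPA : P A ≤ ENNReal.ofReal (Real.exp a))
    (hPQ : ∀ q, 0 ≤ q → P (A ∩ {ω | q < Q ω}) ≤ ENNReal.ofReal (Real.exp (a - (1 + s) * z * q))) :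
    ∫⁻ ω in A, ENNReal.ofReal (Real.exp (z * Q ω)) ∂P ≤
      ENNReal.ofReal ((1 + 1 / s) * Real.exp a) := by
  have hderiv : ∀ b : ℝ, ∫ t in (0 : ℝ)..b, z * Real.exp (z * t) = Real.exp (z * b) - 1 := by
    intro b
    rw [intervalIntegral.integral_const_mul,
      intervalIntegral.integral_comp_mul_left (fun t => Real.exp t) hz.ne',
      integral_exp]
    simp [hz.ne']
  have hlc := lintegral_comp_eq_lintegral_meas_lt_mul (P.restrict A) (f := Q)
    (g := fun t => z * Real.exp (z * t)) (ae_restrict_of_ae hQ0) hQ.aemeasurable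
    (fun t _ => (by fun_prop : Continuous fun t => z * Real.exp (z * t)).intervalIntegrable _ _)
    (Eventually.of_forall fun t => by positivity)
  simp only [hderiv] at hlc
  have hint : IntegrableOn (fun t => Real.exp (-(s * z) * t)) (Set.Ioi 0) :=
    integrableOn_exp_mul_Ioi (by have := mul_pos hs hz; linarith) 0
  have hcake : ∫⁻ ω in A, ENNReal.ofReal (Real.exp (z * Q ω) - 1) ∂P ≤
      ENNReal.ofReal (1 / s * Real.exp a) := by
    rw [hlc]
    calc ∫⁻ t in Set.Ioi 0, P.restrict A {ω | t < Q ω} * ENNReal.ofReal (z * Real.exp (z * t))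
        ≤ ∫⁻ t in Set.Ioi (0 : ℝ),
            ENNReal.ofReal (z * Real.exp a * Real.exp (-(s * z) * t)) := by
          refine setLIntegral_mono' measurableSet_Ioi fun t ht => ?_
          rw [Measure.restrict_apply (measurableSet_lt measurable_const hQ), Set.inter_comm]
          refine (mul_le_mul_left (hPQ t (le_of_lt ht)) _).trans ?_
          rw [← ENNReal.ofReal_mul (Real.exp_pos _).le]
          refine ENNReal.ofReal_le_ofReal (le_of_eq ?_)
          rw [mul_left_comm, ← Real.exp_add, mul_assoc z (Real.exp a), ← Real.exp_add]
          congr 2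
          ring
      _ = ENNReal.ofReal (1 / s * Real.exp a) := by
          rw [← ofReal_integral_eq_lintegral_ofReal (hint.const_mul _)
            (Eventually.of_forall fun t => by positivity), integral_const_mul,
            integral_exp_mul_Ioi (by have := mul_pos hs hz; linarith)]
          congr 1
          simp
          field_simp
  calc ∫⁻ ω in A, ENNReal.ofReal (Real.exp (z * Q ω)) ∂P
      ≤ ∫⁻ ω in A, (ENNReal.ofReal (Real.exp (z * Q ω) - 1) + 1) ∂P := by
        refine lintegral_mono fun ω => ?_
        simp only
        rw [← ENNReal.ofReal_one]
        exact (le_of_eq (by rw [sub_add_cancel])).trans ENNReal.ofReal_add_le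
    _ = ∫⁻ ω in A, ENNReal.ofReal (Real.exp (z * Q ω) - 1) ∂P + P A := by
        rw [lintegral_add_right _ measurable_const]
        simp
    _ ≤ ENNReal.ofReal (1 / s * Real.exp a) + ENNReal.ofReal (Real.exp a) :=
        add_le_add hcake hPA
    _ = ENNReal.ofReal ((1 + 1 / s) * Real.exp a) := by
        rw [← ENNReal.ofReal_add (by positivity) (by positivity)]
        congr 1
        ring

/-- Fubini for the independent pair `R`, `(M, Q)`. -/
lemma lintegral_indep [IsProbabilityMeasure P] {R M Q : Ω → ℝ} (hM : Measurable M)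
    (hQ : Measurable Q) (hR : Measurable R) (hind : IndepFun R (fun ω => (M ω, Q ω)) P)
    {Ψ : ℝ → ℝ → ℝ → ENNReal} (hΨ : Measurable fun p : ℝ × ℝ × ℝ => Ψ p.1 p.2.1 p.2.2) :
    ∫⁻ ω, Ψ (R ω) (M ω) (Q ω) ∂P = ∫⁻ ω, ∫⁻ ω', Ψ (R ω) (M ω') (Q ω') ∂P ∂P ∧
    ∫⁻ ω, Ψ (R ω) (M ω) (Q ω) ∂P = ∫⁻ ω', ∫⁻ ω, Ψ (R ω) (M ω') (Q ω') ∂P ∂P := by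
  have hMQ : Measurable fun ω => (M ω, Q ω) := hM.prodMk hQ
  have hmap := (indepFun_iff_map_prod_eq_prod_map_map hR.aemeasurable hMQ.aemeasurable).1 hind
  have : IsProbabilityMeasure (P.map R) := Measure.isProbabilityMeasure_map hR.aemeasurable
  have : IsProbabilityMeasure (P.map fun ω => (M ω, Q ω)) :=
    Measure.isProbabilityMeasure_map hMQ.aemeasurable
  have h1 : ∫⁻ ω, Ψ (R ω) (M ω) (Q ω) ∂P =
      ∫⁻ p, Ψ p.1 p.2.1 p.2.2 ∂((P.map R).prod (P.map fun ω => (M ω, Q ω))) := by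
    rw [← hmap, lintegral_map hΨ (hR.prodMk hMQ)]
  rw [h1]
  constructor
  · rw [lintegral_prod _ hΨ.aemeasurable, lintegral_map hΨ.lintegral_prod_right' hR]
    refine lintegral_congr fun ω => ?_
    exact lintegral_map (f := fun y : ℝ × ℝ => Ψ (R ω) y.1 y.2)
      (hΨ.comp measurable_prodMk_left) hMQ
  · rw [lintegral_prod_symm _ hΨ.aemeasurable, lintegral_map hΨ.lintegral_prod_left' hMQ]
    refine lintegral_congr fun ω => ?_
    exact lintegral_map (f := fun x : ℝ => Ψ x (M ω) (Q ω))
      (hΨ.comp (measurable_prodMk_right (y := (M ω, Q ω)))) hR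

/-- A perpetuity with `0 ≤ M < 1` and `Q ≥ 0` is nonnegative: the negative part `R⁻` has the
law of `(M R + Q)⁻ ≤ M R⁻`, and a strict inequality `M R⁻ < R⁻` would show in the mean of
`arctan R⁻`. -/
lemma ae_nonneg [IsProbabilityMeasure P] {R M Q : Ω → ℝ} (hM : Measurable M) (hQ : Measurable Q)
    (hR : Measurable R) (hM01 : ∀ᵐ ω ∂P, 0 ≤ M ω ∧ M ω < 1) (hQ0 : ∀ᵐ ω ∂P, 0 ≤ Q ω)
    (hid : IdentDistrib R (fun ω => M ω * R ω + Q ω) P P) : ∀ᵐ ω ∂P, 0 ≤ R ω := by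
  set T : ℝ → ℝ := fun x => Real.arctan (max (-x) 0) with hT
  have hTm : Measurable T := by
    exact Real.measurable_arctan.comp ((measurable_id.neg).max measurable_const)
  have hTint : ∀ Y : Ω → ℝ, Measurable Y → Integrable (fun ω => T (Y ω)) P := fun Y hY =>
    Integrable.of_bound (hTm.comp hY).aestronglyMeasurable (Real.pi / 2)
      (Eventually.of_forall fun ω => (abs_le.2
        ⟨(Real.neg_pi_div_two_lt_arctan _).le, (Real.arctan_lt_pi_div_two _).le⟩))
  have h1 : ∫ ω, T (R ω) ∂P = ∫ ω, T (M ω * R ω + Q ω) ∂P := (hid.comp hTm).integral_eq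
  have h2 : ∀ᵐ ω ∂P, T (M ω * R ω + Q ω) ≤ T (R ω) := by
    filter_upwards [hM01, hQ0] with ω hm hq
    refine Real.arctan_strictMono.monotone (max_le ?_ (le_max_right _ _))
    rcases le_total 0 (R ω) with h | h
    · exact le_max_of_le_right (by nlinarith [mul_nonneg hm.1 h])
    · exact le_max_of_le_left (by nlinarith)
  have h3 : (fun ω => T (R ω) - T (M ω * R ω + Q ω)) =ᵐ[P] 0 := by
    refine (integral_eq_zero_iff_of_nonneg_ae ?_
      ((hTint R hR).sub (hTint _ ((hM.mul hR).add hQ)))).1 ?_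
    · filter_upwards [h2] with ω h using sub_nonneg.2 h
    · exact (integral_sub (hTint R hR) (hTint _ ((hM.mul hR).add hQ))).trans (sub_eq_zero.2 h1)
  filter_upwards [h3, hM01, hQ0] with ω h hm hq
  by_contra! hneg
  have h4 : max (-(M ω * R ω + Q ω)) 0 < max (-(R ω)) 0 := by
    rw [max_eq_left (by linarith : 0 ≤ -R ω)]
    exact max_lt (by nlinarith) (by linarith)
  have h5 := Real.arctan_strictMono h4
  have h6 : T (R ω) - T (M ω * R ω + Q ω) = 0 := h
  simp only [hT] at h6
  linarith

/-- If `Q` has an exponential moment of order `z`, so has `R`: beyond some level `r₀`, one step of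
the recursion at least halves `exp (z R)` in mean. Truncation of `exp (z R)` at `exp (z K)`
makes the comparison of `R` with `M R + Q` legitimate. -/
lemma lintegral_exp_lt_top [IsProbabilityMeasure P] {R M Q : Ω → ℝ} (hM : Measurable M)
    (hQ : Measurable Q) (hR : Measurable R) (hM01 : ∀ᵐ ω ∂P, 0 ≤ M ω ∧ M ω < 1)
    (hR0 : ∀ᵐ ω ∂P, 0 ≤ R ω) (hgen : IsGeneratedBy P R M Q) {z : ℝ} (hz : 0 < z)
    (hQz : ∫⁻ ω, ENNReal.ofReal (Real.exp (z * Q ω)) ∂P < ⊤) :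
    ∫⁻ ω, ENNReal.ofReal (Real.exp (z * R ω)) ∂P < ⊤ := by
  set w : ℝ → ENNReal := fun x => ENNReal.ofReal (Real.exp (z * x)) with hw
  have hwm : Measurable w := by fun_prop
  have hwmono : Monotone w := fun x y h => ENNReal.ofReal_le_ofReal (by gcongr)
  have hwfin : ∀ x, w x ≠ ⊤ := fun x => ENNReal.ofReal_ne_top
  set c := ∫⁻ ω, w (Q ω) ∂P with hc
  -- the mean of `exp (z (M x + Q)) / exp (z x)` tends to `0` as `x → ∞`
  have hlim : Tendsto (fun x : ℝ => ∫⁻ ω, ENNReal.ofReal (Real.exp (z * Q ω - z * (1 - M ω) * x)) ∂P)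
      atTop (𝓝 (∫⁻ _, 0 ∂P)) := by
    refine tendsto_lintegral_filter_of_dominated_convergence (fun ω => w (Q ω))
      (Eventually.of_forall fun x => by fun_prop) ?_ hQz.ne ?_
    · filter_upwards [eventually_ge_atTop 0] with x hx
      filter_upwards [hM01] with ω hm
      refine ENNReal.ofReal_le_ofReal (Real.exp_le_exp.2 ?_)
      have : 0 ≤ z * (1 - M ω) * x := mul_nonneg (mul_nonneg hz.le (by linarith)) hx
      linarith
    · filter_upwards [hM01] with ω hm
      rw [← ENNReal.ofReal_zero]
      refine ENNReal.tendsto_ofReal (Real.tendsto_exp_atBot.comp ?_)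
      have h1 : Tendsto (fun x : ℝ => z * (1 - M ω) * x) atTop atTop :=
        tendsto_id.const_mul_atTop (mul_pos hz (by linarith [hm.2]))
      exact tendsto_atBot_add_const_left _ _ (tendsto_neg_atTop_atBot.comp h1)
  rw [lintegral_zero] at hlim
  have hhalf : (0 : ENNReal) < 2⁻¹ := by simp
  obtain ⟨r₀, hr₀, hr₀'⟩ :=
    ((hlim.eventually_lt_const hhalf).and (eventually_ge_atTop 0)).exists
  have hstep : ∀ x, 0 ≤ x → ∫⁻ ω, w (M ω * x + Q ω) ∂P ≤ w r₀ * c + 2⁻¹ * w x := by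
    intro x hx
    rcases le_total x r₀ with h | h
    · refine le_trans ?_ le_self_add
      rw [hc, ← lintegral_const_mul _ (show Measurable fun ω => w (Q ω) from hwm.comp hQ)]
      refine lintegral_mono_ae ?_
      filter_upwards [hM01] with ω hm
      simp only [hw]
      rw [← ofReal_exp_add, ← mul_add]
      refine ENNReal.ofReal_le_ofReal (Real.exp_le_exp.2 ?_)
      have : M ω * x ≤ x := mul_le_of_le_one_left hx hm.2.le
      gcongr
      linarith
    · refine le_trans ?_ le_add_self
      rw [mul_comm]
      calc ∫⁻ ω, w (M ω * x + Q ω) ∂P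
          = ∫⁻ ω, w x * ENNReal.ofReal (Real.exp (z * Q ω - z * (1 - M ω) * x)) ∂P := by
            refine lintegral_congr fun ω => ?_
            simp only [hw]
            rw [← ofReal_exp_add]
            ring_nf
        _ = w x * ∫⁻ ω, ENNReal.ofReal (Real.exp (z * Q ω - z * (1 - M ω) * x)) ∂P :=
            lintegral_const_mul _ (by fun_prop)
        _ ≤ w x * 2⁻¹ := by
            gcongr
            refine le_trans (lintegral_mono_ae ?_) hr₀.le
            filter_upwards [hM01] with ω hm
            refine ENNReal.ofReal_le_ofReal (Real.exp_le_exp.2 ?_)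
            have : z * (1 - M ω) * r₀ ≤ z * (1 - M ω) * x :=
              mul_le_mul_of_nonneg_left h (mul_nonneg hz.le (by linarith))
            linarith
  set D : ENNReal := w r₀ * c with hD
  have hDfin : D ≠ ⊤ := ENNReal.mul_ne_top (hwfin _) hQz.ne
  have hbound : ∀ K : ℕ, ∫⁻ ω in {ω | R ω ≤ K}, w (R ω) ∂P ≤ 2 * D := by
    intro K
    set S : Set Ω := {ω | R ω ≤ K} with hS
    have hSm : MeasurableSet S := measurableSet_le hR measurable_const
    set V : Ω → ℝ := fun ω => M ω * R ω + Q ω with hV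
    have hcut : Measurable fun x => min (w x) (w K) := hwm.min measurable_const
    have hSfin : ∫⁻ ω in S, w (R ω) ∂P ≠ ⊤ := by
      refine ne_top_of_le_ne_top (hwfin K) ?_
      calc ∫⁻ ω in S, w (R ω) ∂P ≤ ∫⁻ _ in S, w K ∂P :=
            setLIntegral_mono' hSm fun ω hω => hwmono hω
        _ ≤ w K := by
            rw [setLIntegral_const]
            exact mul_le_of_le_one_right' prob_le_one
    have h1 : ∫⁻ ω in S, w (R ω) ∂P ≤ ∫⁻ ω in S, w (V ω) ∂P := by
      have e1 : ∫⁻ ω, min (w (R ω)) (w K) ∂P = ∫⁻ ω, min (w (V ω)) (w K) ∂P :=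
        (hgen.2.comp hcut).lintegral_eq
      rw [← lintegral_add_compl _ hSm, ← lintegral_add_compl (fun ω => min (w (V ω)) (w K)) hSm]
        at e1
      have e2 : ∫⁻ ω in S, min (w (R ω)) (w K) ∂P = ∫⁻ ω in S, w (R ω) ∂P :=
        setLIntegral_congr_fun hSm fun ω hω => min_eq_left (hwmono hω)
      have e3 : ∫⁻ ω in Sᶜ, min (w (R ω)) (w K) ∂P = w K * P Sᶜ := by
        rw [← setLIntegral_const]
        refine setLIntegral_congr_fun hSm.compl fun ω hω => min_eq_right (hwmono ?_)
        exact (not_le.1 (show ¬ R ω ≤ K from hω)).le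
      have e4 : ∫⁻ ω in Sᶜ, min (w (V ω)) (w K) ∂P ≤ w K * P Sᶜ := by
        rw [← setLIntegral_const]
        exact lintegral_mono fun ω => min_le_right _ _
      have e5 : ∫⁻ ω in S, min (w (V ω)) (w K) ∂P ≤ ∫⁻ ω in S, w (V ω) ∂P :=
        lintegral_mono fun ω => min_le_left _ _
      rw [e2, e3] at e1
      have e6 := e1.le.trans (add_le_add e5 e4)
      exact (ENNReal.add_le_add_iff_right
        (ENNReal.mul_ne_top (hwfin K) (measure_ne_top _ _))).1 e6
    have h2 : ∫⁻ ω in S, w (V ω) ∂P ≤ D + 2⁻¹ * ∫⁻ ω in S, w (R ω) ∂P := by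
      have hΨ : Measurable fun p : ℝ × ℝ × ℝ =>
          (Set.Iic (K : ℝ)).indicator (fun _ => w (p.2.1 * p.1 + p.2.2)) p.1 := by
        have : Measurable fun p : ℝ × ℝ × ℝ => w (p.2.1 * p.1 + p.2.2) := by fun_prop
        exact this.indicator (measurable_fst measurableSet_Iic)
      have e1 := (lintegral_indep hM hQ hR hgen.1 (Ψ := fun x m q =>
        (Set.Iic (K : ℝ)).indicator (fun _ => w (m * x + q)) x) hΨ).1
      have e2 : ∫⁻ ω in S, w (V ω) ∂P = ∫⁻ ω, (Set.Iic (K : ℝ)).indicator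
          (fun _ => w (M ω * R ω + Q ω)) (R ω) ∂P := by
        rw [← lintegral_indicator hSm]
        refine lintegral_congr fun ω => ?_
        simp only [Set.indicator, hS, Set.mem_ofPred_eq, Set.mem_Iic, hV]
      rw [e2, e1]
      calc ∫⁻ ω, ∫⁻ ω', (Set.Iic (K : ℝ)).indicator
              (fun _ => w (M ω' * R ω + Q ω')) (R ω) ∂P ∂P
          ≤ ∫⁻ ω, (D + 2⁻¹ * S.indicator (fun ω => w (R ω)) ω) ∂P := by
            refine lintegral_mono_ae ?_
            filter_upwards [hR0] with ω hω
            by_cases hmem : R ω ≤ K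
            · have h3 : ω ∈ S := hmem
              simp only [Set.indicator, Set.mem_Iic, hmem, h3, if_true]
              exact hstep _ hω
            · simp [Set.indicator, hmem]
        _ = D + 2⁻¹ * ∫⁻ ω in S, w (R ω) ∂P := by
            rw [lintegral_add_left measurable_const, lintegral_const_mul _
              ((show Measurable fun ω => w (R ω) from hwm.comp hR).indicator hSm),
              lintegral_indicator hSm]
            simp
    have h3 := h1.trans h2
    set I := ∫⁻ ω in S, w (R ω) ∂P with hI
    have h4 : 2⁻¹ * I + 2⁻¹ * I ≤ D + 2⁻¹ * I := by
      rwa [← add_mul, ENNReal.inv_two_add_inv_two, one_mul]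
    have h5 := (ENNReal.add_le_add_iff_right
      (ENNReal.mul_ne_top (by simp) hSfin)).1 h4
    calc I = 2 * (2⁻¹ * I) := by
          rw [← mul_assoc, ENNReal.mul_inv_cancel (by simp) (by simp), one_mul]
      _ ≤ 2 * D := by gcongr
  have hU : (⋃ K : ℕ, {ω | R ω ≤ K}) = Set.univ := by
    ext ω
    simpa using exists_nat_ge (R ω)
  rw [← setLIntegral_univ, ← hU, setLIntegral_iUnion_of_directed]
  · exact (iSup_le hbound).trans_lt (ENNReal.mul_ne_top (by simp) hDfin).lt_top
  · refine Monotone.directed_le fun i j hij ω (hω : R ω ≤ i) => ?_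
    have : (i : ℝ) ≤ j := by exact_mod_cast hij
    exact le_trans hω this

end ExponentialMoments

/-! ### Convexity of the cumulant generating function of `R` -/

section Cumulant

variable {Ω : Type*} [MeasurableSpace Ω] {P : Measure Ω}

lemma integrable_exp_of_lintegral_lt_top {R : Ω → ℝ} (hR : Measurable R) {z : ℝ}
    (h : ∫⁻ ω, ENNReal.ofReal (Real.exp (z * R ω)) ∂P < ⊤) :
    Integrable (fun ω => Real.exp (z * R ω)) P := by
  refine ⟨by fun_prop, ?_⟩
  rwa [hasFiniteIntegral_iff_ofReal (Eventually.of_forall fun ω => (Real.exp_pos _).le)]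

lemma lintegral_exp_mono {R : Ω → ℝ} (hR0 : ∀ᵐ ω ∂P, 0 ≤ R ω) {w z : ℝ} (hwz : w ≤ z) :
    ∫⁻ ω, ENNReal.ofReal (Real.exp (w * R ω)) ∂P ≤
      ∫⁻ ω, ENNReal.ofReal (Real.exp (z * R ω)) ∂P := by
  refine lintegral_mono_ae ?_
  filter_upwards [hR0] with ω h
  gcongr

variable [IsProbabilityMeasure P]

lemma lintegral_exp_eq_cgf {R : Ω → ℝ} (hR : Measurable R) {z : ℝ}
    (h : ∫⁻ ω, ENNReal.ofReal (Real.exp (z * R ω)) ∂P < ⊤) :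
    ∫⁻ ω, ENNReal.ofReal (Real.exp (z * R ω)) ∂P = ENNReal.ofReal (Real.exp (cgf R P z)) := by
  have hint := integrable_exp_of_lintegral_lt_top hR h
  rw [exp_cgf hint, mgf, ofReal_integral_eq_lintegral_ofReal hint
    (Eventually.of_forall fun ω => (Real.exp_pos _).le)]

lemma cgf_mono {R : Ω → ℝ} (hR : Measurable R) (hR0 : ∀ᵐ ω ∂P, 0 ≤ R ω) {w z : ℝ} (hwz : w ≤ z)
    (h : ∫⁻ ω, ENNReal.ofReal (Real.exp (z * R ω)) ∂P < ⊤) : cgf R P w ≤ cgf R P z := by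
  have h1 := lintegral_exp_mono hR0 hwz
  rw [lintegral_exp_eq_cgf hR (h1.trans_lt h), lintegral_exp_eq_cgf hR h,
    ENNReal.ofReal_le_ofReal_iff (Real.exp_pos _).le, Real.exp_le_exp] at h1
  exact h1

/-- Hölder's inequality makes the cumulant generating function convex where it is finite. -/
lemma convexOn_cgf {R : Ω → ℝ} (hR : Measurable R) (hR0 : ∀ᵐ ω ∂P, 0 ≤ R ω) {z : ℝ}
    (h : ∫⁻ ω, ENNReal.ofReal (Real.exp (z * R ω)) ∂P < ⊤) :
    ConvexOn ℝ (Set.Iic z) (cgf R P) := by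
  refine ⟨convex_Iic z, fun v hv w hw a b ha hb hab => ?_⟩
  have hfin : ∀ x ∈ Set.Iic z, ∫⁻ ω, ENNReal.ofReal (Real.exp (x * R ω)) ∂P < ⊤ :=
    fun x hx => (lintegral_exp_mono hR0 hx).trans_lt h
  have hmem : a • v + b • w ∈ Set.Iic z := convex_Iic z hv hw ha hb hab
  have hpow : ∀ c x y : ℝ, ENNReal.ofReal (Real.exp (x * y)) ^ c =
      ENNReal.ofReal (Real.exp (c * x * y)) := by
    intro c x y
    rw [ENNReal.ofReal_rpow_of_pos (Real.exp_pos _), ← Real.exp_mul]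
    congr 2
    ring
  have hpow' : ∀ c x : ℝ, ENNReal.ofReal (Real.exp x) ^ c = ENNReal.ofReal (Real.exp (c * x)) := by
    intro c x
    rw [ENNReal.ofReal_rpow_of_pos (Real.exp_pos _), ← Real.exp_mul, mul_comm]
  have holder := ENNReal.lintegral_mul_norm_pow_le (μ := P)
    (f := fun ω => ENNReal.ofReal (Real.exp (v * R ω)))
    (g := fun ω => ENNReal.ofReal (Real.exp (w * R ω))) (by fun_prop) (by fun_prop) ha hb hab
  rw [lintegral_exp_eq_cgf hR (hfin v hv), lintegral_exp_eq_cgf hR (hfin w hw), hpow', hpow',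
    ← ofReal_exp_add] at holder
  have hl : ∫⁻ ω, ENNReal.ofReal (Real.exp (v * R ω)) ^ a *
      ENNReal.ofReal (Real.exp (w * R ω)) ^ b ∂P =
      ∫⁻ ω, ENNReal.ofReal (Real.exp ((a • v + b • w) * R ω)) ∂P := by
    refine lintegral_congr fun ω => ?_
    rw [hpow, hpow, ← ofReal_exp_add, smul_eq_mul, smul_eq_mul, add_mul]
  rw [hl, lintegral_exp_eq_cgf hR (hfin _ hmem), ENNReal.ofReal_le_ofReal_iff (Real.exp_pos _).le,
    Real.exp_le_exp] at holder
  simpa using holder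

lemma slope_le_slope {f : ℝ → ℝ} {S : Set ℝ} (hf : ConvexOn ℝ S f) {v w x y : ℝ} (hv : v ∈ S)
    (hw : w ∈ S) (hx : x ∈ S) (hy : y ∈ S) (hvw : v < w) (hwx : w ≤ x) (hxy : x < y) :
    (f w - f v) / (w - v) ≤ (f y - f x) / (y - x) := by
  rcases hwx.eq_or_lt with rfl | hlt
  · exact hf.slope_mono_adjacent hv hy hvw hxy
  · exact (hf.slope_mono_adjacent hv hx hvw hlt).trans (hf.slope_mono_adjacent hw hy hlt hxy)

/-- If the one-step exponential moment with the linear penalty `y · min (1 - M) δ` is below `1`,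
then the slopes of the cumulant generating function to the left of `(1 - δ) z` are at most `y / z`.
Otherwise convexity would bound `cgf R P (z M)` by `cgf R P z` minus the penalty, and
`E exp (z R) = E exp (z Q) exp (cgf R P (z M))` would be strictly smaller than itself. -/
lemma mul_cgf_sub_le {R M Q : Ω → ℝ} (hM : Measurable M)
    (hQ : Measurable Q) (hR : Measurable R) (hM01 : ∀ᵐ ω ∂P, 0 ≤ M ω ∧ M ω < 1)
    (hR0 : ∀ᵐ ω ∂P, 0 ≤ R ω) (hgen : IsGeneratedBy P R M Q) {z δ y w₁ w₂ : ℝ} (hz : 0 < z)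
    (hδ : 0 < δ) (hRz : ∫⁻ ω, ENNReal.ofReal (Real.exp (z * R ω)) ∂P < ⊤)
    (hy : ∫⁻ ω, ENNReal.ofReal (Real.exp (z * Q ω - y * min (1 - M ω) δ)) ∂P < 1)
    (hw : w₁ < w₂) (hwz : w₂ ≤ (1 - δ) * z) :
    z * (cgf R P w₂ - cgf R P w₁) ≤ y * (w₂ - w₁) := by
  by_contra! hcon
  have hconv := convexOn_cgf hR hR0 hRz
  have hδz : (1 - δ) * z < z := by nlinarith
  have hw₂ : w₂ ∈ Set.Iic z := hwz.trans hδz.le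
  have hw₁ : w₁ ∈ Set.Iic z := hw.le.trans hw₂
  have hslope : y / z ≤ (cgf R P w₂ - cgf R P w₁) / (w₂ - w₁) := by
    rw [div_le_div_iff₀ hz (sub_pos.2 hw)]
    linarith
  have htang : ∀ x, w₂ ≤ x → x < z → cgf R P x ≤ cgf R P z - y / z * (z - x) := by
    intro x hx hxz
    have := hslope.trans (slope_le_slope hconv hw₁ hw₂ hxz.le (Set.mem_Iic.2 le_rfl) hw hx hxz)
    rw [le_div_iff₀ (sub_pos.2 hxz)] at this
    linarith
  have hpoint : ∀ m, 0 ≤ m → m < 1 → cgf R P (z * m) ≤ cgf R P z - y * min (1 - m) δ := by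
    intro m hm0 hm1
    have hzm : z * m < z := by nlinarith
    rcases le_total (1 - m) δ with h | h
    · have h1 := htang (z * m) (hwz.trans (by nlinarith)) hzm
      have h2 : y / z * (z - z * m) = y * (1 - m) := by field_simp
      rw [min_eq_left h]
      linarith
    · have h1 := htang ((1 - δ) * z) hwz hδz
      have h2 : y / z * (z - (1 - δ) * z) = y * δ := by field_simp; ring
      have h3 : cgf R P (z * m) ≤ cgf R P ((1 - δ) * z) :=
        cgf_mono hR hR0 (by nlinarith) ((lintegral_exp_mono hR0 hδz.le).trans_lt hRz)
      rw [min_eq_right h]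
      linarith
  set m₀ := ∫⁻ ω, ENNReal.ofReal (Real.exp (z * R ω)) ∂P with hm₀
  have hm₀e : m₀ = ENNReal.ofReal (Real.exp (cgf R P z)) := lintegral_exp_eq_cgf hR hRz
  have hm₀0 : m₀ ≠ 0 := by
    rw [hm₀e]
    simpa using Real.exp_pos _
  have hself : m₀ ≤ m₀ * ∫⁻ ω, ENNReal.ofReal (Real.exp (z * Q ω - y * min (1 - M ω) δ)) ∂P := by
    have e1 : m₀ = ∫⁻ ω, ENNReal.ofReal (Real.exp (z * (M ω * R ω + Q ω))) ∂P :=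
      (hgen.2.comp (u := fun x => ENNReal.ofReal (Real.exp (z * x))) (by fun_prop)).lintegral_eq
    have e2 := (lintegral_indep hM hQ hR hgen.1 (Ψ := fun x m q =>
        ENNReal.ofReal (Real.exp (z * (m * x + q)))) (by fun_prop)).2
    calc m₀ = ∫⁻ ω', ∫⁻ ω, ENNReal.ofReal (Real.exp (z * (M ω' * R ω + Q ω'))) ∂P ∂P := e1.trans e2
      _ ≤ ∫⁻ ω', m₀ * ENNReal.ofReal (Real.exp (z * Q ω' - y * min (1 - M ω') δ)) ∂P := by
          refine lintegral_mono_ae ?_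
          filter_upwards [hM01] with ω' hm
          have hzM : z * M ω' ≤ z := mul_le_of_le_one_right hz.le hm.2.le
          calc ∫⁻ ω, ENNReal.ofReal (Real.exp (z * (M ω' * R ω + Q ω'))) ∂P
              = ∫⁻ ω, ENNReal.ofReal (Real.exp (z * Q ω')) *
                  ENNReal.ofReal (Real.exp (z * M ω' * R ω)) ∂P := by
                refine lintegral_congr fun ω => ?_
                rw [← ofReal_exp_add]
                congr 2
                ring
            _ = ENNReal.ofReal (Real.exp (z * Q ω')) *
                  ENNReal.ofReal (Real.exp (cgf R P (z * M ω'))) := by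
                rw [lintegral_const_mul _ (by fun_prop),
                  lintegral_exp_eq_cgf hR ((lintegral_exp_mono hR0 hzM).trans_lt hRz)]
            _ ≤ m₀ * ENNReal.ofReal (Real.exp (z * Q ω' - y * min (1 - M ω') δ)) := by
                rw [hm₀e, ← ofReal_exp_add, ← ofReal_exp_add]
                refine ENNReal.ofReal_le_ofReal (Real.exp_le_exp.2 ?_)
                linarith [hpoint (M ω') hm.1 hm.2]
      _ = _ := lintegral_const_mul _ (by fun_prop)
  have : m₀ * ∫⁻ ω, ENNReal.ofReal (Real.exp (z * Q ω - y * min (1 - M ω) δ)) ∂P < m₀ * 1 :=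
    ENNReal.mul_lt_mul_right hm₀0 hRz.ne hy
  rw [mul_one] at this
  exact absurd hself (not_le.2 this)

end Cumulant

/-! ### The exponential moment of one step of the recursion -/

section OneStep

variable {Ω : Type*} [MeasurableSpace Ω]

/-- Upper bounds for the tails of `(M, Q)` in terms of the marginal exponents `φ`, `k` and a
regularly varying rate `H` of index `γ`: up to `1 - ε` and an additive constant,
`-log P(M > 1 - 1/t, Q > q)` is at least `H(q t) / t`, while `H` lies below the cost of the
marginal exponents. -/
structure JointTailBound (P : Measure Ω) (M Q : Ω → ℝ) (φ k H : ℝ → ℝ) (r α γ : ℝ) : Prop where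
  exponents : TailExponents φ k r α
  one_lt_γ : 1 < γ
  regVar : RegVar H γ
  mono : Monotone H
  nonneg : ∀ x, 0 ≤ H x
  M_tail : ∀ t, 1 ≤ t → P {ω | 1 - 1 / t < M ω} ≤ ENNReal.ofReal (Real.exp (-φ t))
  Q_tail : ∀ q, P {ω | q < Q ω} ≤ ENNReal.ofReal (Real.exp (-k q))
  le_cost : ∀ x t, 1 ≤ t → H x ≤ t * φ t + t * k (x / t)
  joint_tail : ∀ ε, 0 < ε → ε < 1 → ∃ C, ∀ t q, 1 ≤ t → 0 ≤ q →
    P ({ω | 1 - 1 / t < M ω} ∩ {ω | q < Q ω}) ≤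
      ENNReal.ofReal (Real.exp (-(((1 - ε) * H (q * t) - C) / t)))

namespace JointTailBound

variable {P : Measure Ω} {M Q : Ω → ℝ} {φ k H : ℝ → ℝ} {r α γ : ℝ}

lemma tendsto_H (J : JointTailBound P M Q φ k H r α γ) : Tendsto H atTop atTop :=
  J.regVar.tendsto_atTop (by linarith [J.one_lt_γ]) (J.mono.monotoneOn _)

/-- The joint tail bound, linearized by Young's inequality. -/
lemma joint_le (J : JointTailBound P M Q φ k H r α γ) {p p' q₀ b : ℝ} (hp' : 0 < p')
    (hpp : p' < p) (hpq : ∀ v, 0 ≤ v → p * v - v ^ γ ≤ q₀) (hb : q₀ < b) :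
    ∀ᶠ x in atTop, ∀ t q, 1 ≤ t → 0 ≤ q →
      P ({ω | 1 - 1 / t < M ω} ∩ {ω | q < Q ω}) ≤
        ENNReal.ofReal (Real.exp (b * H x / t - p' * (H x / x) * q)) := by
  obtain ⟨ε, hε0, hε1, hε⟩ := J.regVar.young_perturbed J.one_lt_γ J.mono J.nonneg hp' hpp hpq hb
  obtain ⟨C, hC⟩ := J.joint_tail ε hε0 hε1
  filter_upwards [hε C] with x hx t q ht hq
  have ht0 : 0 < t := by linarith
  refine (hC t q ht hq).trans (ENNReal.ofReal_le_ofReal (Real.exp_le_exp.2 ?_))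
  have h1 := hx (q * t) (by positivity)
  have h2 : (p' * (q * t / x) * H x - b * H x) / t ≤ ((1 - ε) * H (q * t) - C) / t := by gcongr
  have h3 : (p' * (q * t / x) * H x - b * H x) / t = p' * (H x / x) * q - b * H x / t := by
    field_simp
  linarith

/-- The tail of `Q` alone has the same form, with `t` replaced by an arbitrary fixed `T`. -/
lemma Q_le (J : JointTailBound P M Q φ k H r α γ) {p p' q₀ b T : ℝ} (hT : 1 ≤ T) (hp' : 0 < p')
    (hpp : p' < p) (hpq : ∀ v, 0 ≤ v → p * v - v ^ γ ≤ q₀) (hb : q₀ < b) :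
    ∀ᶠ x in atTop, ∀ q, 0 ≤ q → P {ω | q < Q ω} ≤
      ENNReal.ofReal (Real.exp (φ T + b * H x / T - p' * (H x / x) * q)) := by
  obtain ⟨ε, hε0, hε1, hε⟩ := J.regVar.young_perturbed J.one_lt_γ J.mono J.nonneg hp' hpp hpq hb
  have hT0 : 0 < T := by linarith
  filter_upwards [hε 0] with x hx q hq
  refine (J.Q_tail q).trans (ENNReal.ofReal_le_ofReal (Real.exp_le_exp.2 ?_))
  have h1 := hx (q * T) (by positivity)
  have h2 := J.le_cost (q * T) T hT
  rw [mul_div_cancel_right₀ _ hT0.ne', ← mul_add] at h2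
  have h4 : (1 - ε) * H (q * T) ≤ H (q * T) :=
    mul_le_of_le_one_left (J.nonneg _) (by linarith)
  have h5 : (p' * (q * T / x) * H x - b * H x) / T ≤ φ T + k q := by
    rw [div_le_iff₀ hT0]
    linarith
  have h3 : (p' * (q * T / x) * H x - b * H x) / T = p' * (H x / x) * q - b * H x / T := by
    field_simp
  linarith

lemma summable_exp_neg_φ (E : TailExponents φ k r α) {η c : ℝ} (hη : 1 < η) (hc : 0 < c) :
    Summable fun j : ℕ => Real.exp (-(c * φ (η ^ j))) := by
  have hr := E.one_lt_r
  have h1η : (1 : ℝ) < η ^ (r - 1) := Real.one_lt_rpow hη (by linarith)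
  obtain ⟨a, ha1, ha2⟩ := exists_between h1η
  have hpow : Tendsto (fun j : ℕ => η ^ j) atTop atTop := tendsto_pow_atTop_atTop_of_one_lt hη
  refine summable_of_ratio_norm_eventually_le (r := Real.exp (-c)) (by simpa using hc) ?_
  filter_upwards [hpow.eventually (E.φ_regVar.eventually_mul_le (by linarith) ha2),
    hpow.eventually (E.tendsto_φ.eventually_ge_atTop (a - 1)⁻¹)] with j h1 h2
  rw [Real.norm_of_nonneg (Real.exp_pos _).le, Real.norm_of_nonneg (Real.exp_pos _).le,
    ← Real.exp_add, Real.exp_le_exp, pow_succ']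
  rw [inv_le_iff_one_le_mul₀' (by linarith)] at h2
  have h3 : φ (η ^ j) + 1 ≤ φ (η * η ^ j) := by linarith
  nlinarith

/-- With `z = γ H(x) / x` and penalty `y = b H(x)`, `b > γ - 1`, the one-step exponential moment is
small. The values of `1 - M` below `δ` are split into geometric cells `1 - M ≈ 1 / η ^ j`; the
contribution of each cell tends to `0` by the joint tail bound, and the marginal tail of `M`
makes the contributions summable uniformly in `x`. -/
theorem eventually_moment_lt_one [IsProbabilityMeasure P] (J : JointTailBound P M Q φ k H r α γ)
    (hM : Measurable M) (hQ : Measurable Q) (hM01 : ∀ᵐ ω ∂P, 0 ≤ M ω ∧ M ω < 1)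
    (hQ0 : ∀ᵐ ω ∂P, 0 ≤ Q ω) {b δ : ℝ} (hb : γ - 1 < b) (hδ : 0 < δ) (hδ1 : δ < 1) :
    ∀ᶠ x in atTop,
      ∫⁻ ω, ENNReal.ofReal (Real.exp (γ * (H x / x) * Q ω)) ∂P < ⊤ ∧
      ∫⁻ ω, ENNReal.ofReal (Real.exp (γ * (H x / x) * Q ω - b * H x * min (1 - M ω) δ)) ∂P
        < 1 := by
  have hγ := J.one_lt_γ
  have E := J.exponents
  have hφ0 := E.φ_nonneg
  -- the constants: `(γ - 1) c ^ γ < b₁ < b / η²` and `γ < (1 + s) γ < γ c ^ (γ - 1)`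
  obtain ⟨b₁, hb₁, hb₁b⟩ := exists_between hb
  have hb₁0 : 0 < b₁ := by linarith
  obtain ⟨c, hc1, hc⟩ := exists_one_lt_mul_rpow_lt hb₁ γ
  have hcγ : 1 < c ^ (γ - 1) := Real.one_lt_rpow hc1 (by linarith)
  obtain ⟨s', hs1, hs2⟩ := exists_between hcγ
  obtain ⟨s, rfl⟩ : ∃ s, s' = 1 + s := ⟨s' - 1, by ring⟩
  have hs : 0 < s := by linarith
  obtain ⟨η₀, hη₀1, hη₀⟩ := exists_one_lt_mul_rpow_lt hb₁b 2
  set η := min η₀ δ⁻¹ with hη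
  have hη1 : 1 < η := lt_min hη₀1 ((one_lt_inv₀ hδ).2 hδ1)
  have hη0 : 0 < η := by linarith
  have hηδ : δ * η ≤ 1 := by
    have : δ * η ≤ δ * δ⁻¹ := by gcongr; exact min_le_right _ _
    rwa [mul_inv_cancel₀ hδ.ne'] at this
  have hηb : b₁ * η ^ 2 < b := by
    have h1 : b₁ * η ^ 2 ≤ b₁ * η₀ ^ 2 := by gcongr; exact min_le_left _ _
    rw [Real.rpow_two] at hη₀
    linarith
  set c₀ := b / η ^ 2 - b₁ with hc₀
  have hc₀0 : 0 < c₀ := sub_pos.2 ((lt_div_iff₀ (by positivity)).2 hηb)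
  obtain ⟨q₂, hq₂0, hq₂⟩ := exists_young_const hγ (p := 2 * (γ * c ^ (γ - 1))) (by positivity)
  set b₂ := q₂ + 1 with hb₂
  have hb₂0 : 0 < b₂ := by linarith
  set c₁ := c₀ / (2 * c₀ + b₂) with hc₁
  have hc₁0 : 0 < c₁ := by positivity
  set t : ℕ → ℝ := fun j => η ^ j with ht
  set K := 1 + 1 / s with hK
  have hK0 : 0 < K := by positivity
  set B : ℝ → ℕ → ℝ := fun x j =>
    K * min (Real.exp (-(c₀ * (H x / t j)))) (Real.exp (-(c₁ * φ (t j)))) with hB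
  have ht1 : ∀ j, 1 ≤ t j := fun j => one_le_pow₀ hη1.le
  have ht0 : ∀ j, 0 < t j := fun j => by linarith [ht1 j]
  set T := max 1 (2 * b₁ / (b * δ)) with hT
  have hT1 : 1 ≤ T := le_max_left _ _
  have hb0 : 0 < b := by linarith
  have hTb : b₁ / T ≤ b * δ / 2 := by
    have h1 : 2 * b₁ / (b * δ) ≤ T := le_max_right _ _
    rw [div_le_iff₀ (by positivity)] at h1
    rw [div_le_iff₀ (by linarith)]
    linarith
  -- the sum of the bounds tends to `0` by dominated convergence
  have hsum : ∀ x, Summable (B x) := fun x =>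
    Summable.of_nonneg_of_le (fun j => by positivity)
      (fun j => mul_le_mul_of_nonneg_left (min_le_right _ _) hK0.le)
      ((summable_exp_neg_φ E hη1 hc₁0).mul_left K)
  have hlimB : Tendsto (fun x => ∑' j, B x j) atTop (𝓝 0) := by
    have : Tendsto (fun x => ∑' j, B x j) atTop (𝓝 (∑' _ : ℕ, (0 : ℝ))) := by
      refine tendsto_tsum_of_dominated_convergence
        ((summable_exp_neg_φ E hη1 hc₁0).mul_left K) (fun j => ?_)
        (Eventually.of_forall fun x j => ?_)
      · have h1 : Tendsto (fun x => Real.exp (-(c₀ * (H x / t j)))) atTop (𝓝 0) :=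
          Real.tendsto_exp_neg_atTop_nhds_zero.comp
            ((J.tendsto_H.atTop_div_const (ht0 j)).const_mul_atTop hc₀0)
        have h2 : Tendsto (fun x => K * Real.exp (-(c₀ * (H x / t j)))) atTop (𝓝 0) := by
          simpa using h1.const_mul K
        exact squeeze_zero (fun x => by positivity)
          (fun x => mul_le_mul_of_nonneg_left (min_le_left _ _) hK0.le) h2
      · rw [Real.norm_of_nonneg (by positivity)]
        exact mul_le_mul_of_nonneg_left (min_le_right _ _) hK0.le
    simpa using this
  have hlimT : Tendsto (fun x => K * Real.exp (φ T) * Real.exp (-(b * δ / 2 * H x))) atTop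
      (𝓝 0) := by
    have h1 : Tendsto (fun x => Real.exp (-(b * δ / 2 * H x))) atTop (𝓝 0) :=
      Real.tendsto_exp_neg_atTop_nhds_zero.comp
        (J.tendsto_H.const_mul_atTop (by positivity))
    simpa using h1.const_mul (K * Real.exp (φ T))
  have hlim : Tendsto (fun x => K * Real.exp (φ T) * Real.exp (-(b * δ / 2 * H x)) + ∑' j, B x j)
      atTop (𝓝 0) := by simpa using hlimT.add hlimB
  have hyoung : ∀ v, 0 ≤ v → γ * c ^ (γ - 1) * v - v ^ γ ≤ (γ - 1) * c ^ γ :=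
    fun v hv => young_scaled hγ (by linarith) hv
  have hsγ : (1 + s) * γ < γ * c ^ (γ - 1) := by nlinarith
  filter_upwards [hlim.eventually_lt_const one_pos, J.regVar.pos, eventually_gt_atTop 0,
    J.joint_le (by positivity) hsγ hyoung hc,
    J.joint_le (p' := 2 * ((1 + s) * γ)) (by positivity) (by linarith) hq₂ (lt_add_one q₂),
    J.Q_le hT1 (by positivity) hsγ hyoung hc] with x hx1 hHx hx0 hj1 hj2 hq1
  set z := γ * (H x / x) with hz
  have hz0 : 0 < z := by positivity
  have hQz : ∫⁻ ω, ENNReal.ofReal (Real.exp (z * Q ω)) ∂P ≤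
      ENNReal.ofReal (K * Real.exp (φ T + b₁ * H x / T)) := by
    have := setLIntegral_exp_le hQ hQ0 (A := Set.univ) (a := φ T + b₁ * H x / T) hz0 hs (by
      rw [measure_univ, ← ENNReal.ofReal_one]
      refine ENNReal.ofReal_le_ofReal (Real.one_le_exp ?_)
      have := hφ0 T hT1
      positivity) (fun q hq => by
      rw [Set.univ_inter]
      convert hq1 q hq using 4
      rw [hz]; ring)
    rwa [setLIntegral_univ] at this
  refine ⟨hQz.trans_lt ENNReal.ofReal_lt_top, ?_⟩
  -- the two bounds on the event `1 - M < 1 / t`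
  have hcell : ∀ j, (∫⁻ ω in {ω | 1 - 1 / t j < M ω}, ENNReal.ofReal (Real.exp (z * Q ω)) ∂P) *
      ENNReal.ofReal (Real.exp (-(b * H x / (η ^ 2 * t j)))) ≤ ENNReal.ofReal (B x j) := by
    intro j
    have htj := ht0 j
    have hφj := hφ0 _ (ht1 j)
    set A : Set Ω := {ω | 1 - 1 / t j < M ω} with hA
    have hA1 : P A ≤ ENNReal.ofReal (Real.exp (-φ (t j))) := J.M_tail _ (ht1 j)
    have h1 : ∫⁻ ω in A, ENNReal.ofReal (Real.exp (z * Q ω)) ∂P ≤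
        ENNReal.ofReal (K * Real.exp (b₁ * H x / t j)) :=
      setLIntegral_exp_le hQ hQ0 hz0 hs (prob_le_one.trans (by
        rw [← ENNReal.ofReal_one]
        exact ENNReal.ofReal_le_ofReal (Real.one_le_exp (by positivity))))
        (fun q hq => by
          convert hj1 (t j) q (ht1 j) hq using 4
          rw [hz]; ring)
    have h2 : ∫⁻ ω in A, ENNReal.ofReal (Real.exp (z * Q ω)) ∂P ≤
        ENNReal.ofReal (K * Real.exp (b₂ * H x / t j / 2 - φ (t j) / 2)) := by
      refine setLIntegral_exp_le hQ hQ0 hz0 hs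
        (hA1.trans (ENNReal.ofReal_le_ofReal (Real.exp_le_exp.2 ?_))) (fun q hq => ?_)
      · have : 0 ≤ b₂ * H x / t j / 2 := by positivity
        linarith
      · -- a probability below `exp u` and below `exp v` is below `exp ((u + v) / 2)`
        have e1 : P (A ∩ {ω | q < Q ω}) ≤ ENNReal.ofReal (Real.exp (-φ (t j))) :=
          (measure_mono Set.inter_subset_left).trans hA1
        have e2 := hj2 (t j) q (ht1 j) hq
        have e3 := le_min e1 e2
        rw [← ENNReal.ofReal_min, ← Real.exp_monotone.map_min] at e3
        refine e3.trans (ENNReal.ofReal_le_ofReal (Real.exp_le_exp.2 ?_))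
        have e4 : (1 + s) * z * q = 2 * ((1 + s) * γ) * (H x / x) * q / 2 := by rw [hz]; ring
        rw [e4]
        rcases min_cases (-φ (t j)) (b₂ * H x / t j - 2 * ((1 + s) * γ) * (H x / x) * q) with
          h | h <;> linarith [h.1, h.2]
    have hdec : b * H x / (η ^ 2 * t j) = (c₀ + b₁) * (H x / t j) := by
      rw [hc₀]
      field_simp
      ring
    have h1' : (∫⁻ ω in A, ENNReal.ofReal (Real.exp (z * Q ω)) ∂P) *
        ENNReal.ofReal (Real.exp (-(b * H x / (η ^ 2 * t j)))) ≤
        ENNReal.ofReal (K * Real.exp (-(c₀ * (H x / t j)))) := by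
      refine (mul_le_mul_left h1 _).trans (le_of_eq ?_)
      rw [← ENNReal.ofReal_mul (by positivity), mul_assoc, ← Real.exp_add, hdec]
      congr 3
      ring
    have h2' : (∫⁻ ω in A, ENNReal.ofReal (Real.exp (z * Q ω)) ∂P) *
        ENNReal.ofReal (Real.exp (-(b * H x / (η ^ 2 * t j)))) ≤
        ENNReal.ofReal (K * Real.exp (b₂ * H x / t j / 2 - φ (t j) / 2)) := by
      refine (mul_le_of_le_one_right' ?_).trans h2
      rw [← ENNReal.ofReal_one]
      refine ENNReal.ofReal_le_ofReal (Real.exp_le_one_iff.2 ?_)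
      have : 0 ≤ b * H x / (η ^ 2 * t j) := by positivity
      linarith
    refine (le_min h1' h2').trans ?_
    rw [← ENNReal.ofReal_min, ← mul_min_of_nonneg _ _ hK0.le]
    refine ENNReal.ofReal_le_ofReal (mul_le_mul_of_nonneg_left (le_min (min_le_left _ _) ?_) hK0.le)
    rw [← Real.exp_monotone.map_min, Real.exp_le_exp]
    -- the convex combination of the two exponents in which `H x / t` cancels
    set m := min (-(c₀ * (H x / t j))) (b₂ * H x / t j / 2 - φ (t j) / 2) with hm
    have hm1 : m ≤ -(c₀ * (H x / t j)) := min_le_left _ _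
    have hm2 : m ≤ b₂ * H x / t j / 2 - φ (t j) / 2 := min_le_right _ _
    have hd : 0 < 2 * c₀ + b₂ := by positivity
    have e5 : (2 * c₀ + b₂) * m ≤ -(c₀ * φ (t j)) := by
      have f1 := mul_le_mul_of_nonneg_left hm1 hb₂0.le
      have f2 := mul_le_mul_of_nonneg_left hm2 (by positivity : 0 ≤ 2 * c₀)
      have f3 : 2 * c₀ * (b₂ * H x / t j / 2 - φ (t j) / 2) =
        b₂ * (c₀ * (H x / t j)) - c₀ * φ (t j) := by ring
      linarith
    have e6 : -(c₁ * φ (t j)) = -(c₀ * φ (t j)) / (2 * c₀ + b₂) := by rw [hc₁]; ring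
    rw [e6, le_div_iff₀ hd]
    linarith
  have hpoint : ∀ᵐ ω ∂P, ENNReal.ofReal (Real.exp (z * Q ω - b * H x * min (1 - M ω) δ)) ≤
      ENNReal.ofReal (Real.exp (z * Q ω)) * ENNReal.ofReal (Real.exp (-(b * H x * δ))) +
      ∑' j, {ω | 1 - 1 / t j < M ω}.indicator
        (fun ω => ENNReal.ofReal (Real.exp (z * Q ω))) ω *
          ENNReal.ofReal (Real.exp (-(b * H x / (η ^ 2 * t j)))) := by
    filter_upwards [hM01] with ω hm
    rw [sub_eq_add_neg, ofReal_exp_add]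
    have hbH : 0 ≤ b * H x := by positivity
    rcases le_total δ (1 - M ω) with h | h
    · rw [min_eq_right h]
      exact le_self_add
    · rw [min_eq_left h]
      refine le_trans ?_ le_add_self
      have hu : 0 < 1 - M ω := sub_pos.2 hm.2
      obtain ⟨j, hj1, hj2⟩ := exists_nat_pow_near (x := 1 / ((1 - M ω) * η))
        ((one_le_div (by positivity)).2
          ((mul_le_mul_of_nonneg_right h hη0.le).trans hηδ)) hη1
      rw [le_div_iff₀ (by positivity)] at hj1
      rw [div_lt_iff₀ (by positivity)] at hj2
      refine le_trans ?_ (ENNReal.le_tsum j)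
      have hmem : 1 - 1 / t j < M ω := by
        have : 1 - M ω < 1 / t j := by
          rw [lt_div_iff₀ (ht0 j)]
          have : 0 < (1 - M ω) * η ^ j := by positivity
          calc (1 - M ω) * η ^ j < (1 - M ω) * η ^ j * η := lt_mul_of_one_lt_right this hη1
            _ = η ^ j * ((1 - M ω) * η) := by ring
            _ ≤ 1 := hj1
        linarith
      rw [Set.indicator_of_mem (show ω ∈ {ω | 1 - 1 / t j < M ω} from hmem)]
      gcongr
      have htj := ht0 j
      have h1 : 1 / (η ^ 2 * t j) ≤ 1 - M ω := by
        rw [div_le_iff₀ (by positivity)]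
        calc 1 ≤ η ^ (j + 1) * ((1 - M ω) * η) := hj2.le
          _ = (1 - M ω) * (η ^ 2 * t j) := by simp only [ht]; ring
      calc b * H x / (η ^ 2 * t j) = b * H x * (1 / (η ^ 2 * t j)) := by ring
        _ ≤ b * H x * (1 - M ω) := by gcongr
  have hAm : ∀ j, MeasurableSet {ω | 1 - 1 / t j < M ω} := fun j =>
    measurableSet_lt measurable_const hM
  have hem : Measurable fun ω => ENNReal.ofReal (Real.exp (z * Q ω)) := by fun_prop
  calc ∫⁻ ω, ENNReal.ofReal (Real.exp (z * Q ω - b * H x * min (1 - M ω) δ)) ∂P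
      ≤ (∫⁻ ω, ENNReal.ofReal (Real.exp (z * Q ω)) ∂P) *
            ENNReal.ofReal (Real.exp (-(b * H x * δ))) +
          ∑' j, (∫⁻ ω in {ω | 1 - 1 / t j < M ω}, ENNReal.ofReal (Real.exp (z * Q ω)) ∂P) *
            ENNReal.ofReal (Real.exp (-(b * H x / (η ^ 2 * t j)))) := by
        refine (lintegral_mono_ae hpoint).trans (le_of_eq ?_)
        rw [lintegral_add_left (hem.mul_const _), lintegral_mul_const _ hem,
          lintegral_tsum fun j => ((hem.indicator (hAm j)).mul_const _).aemeasurable]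
        congr 2
        ext j
        rw [lintegral_mul_const _ (hem.indicator (hAm j)), lintegral_indicator (hAm j)]
    _ ≤ ENNReal.ofReal (K * Real.exp (φ T) * Real.exp (-(b * δ / 2 * H x))) +
          ∑' j, ENNReal.ofReal (B x j) := by
        refine add_le_add ?_ (ENNReal.tsum_le_tsum hcell)
        refine (mul_le_mul_left hQz _).trans ?_
        rw [← ENNReal.ofReal_mul (by positivity), mul_assoc K (Real.exp (_ + _)), ← Real.exp_add,
          mul_assoc K, ← Real.exp_add]
        refine ENNReal.ofReal_le_ofReal
          (mul_le_mul_of_nonneg_left (Real.exp_le_exp.2 ?_) hK0.le)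
        have h1 := mul_le_mul_of_nonneg_right hTb hHx.le
        have h2 : b₁ / T * H x = b₁ * H x / T := by ring
        linarith
    _ = ENNReal.ofReal (K * Real.exp (φ T) * Real.exp (-(b * δ / 2 * H x)) + ∑' j, B x j) := by
        have hB0 : ∀ j, 0 ≤ B x j := fun j => by positivity
        rw [← ENNReal.ofReal_tsum_of_nonneg hB0 (hsum x),
          ENNReal.ofReal_add (by positivity) (tsum_nonneg hB0)]
    _ < 1 := by
        rw [← ENNReal.ofReal_one]
        exact (ENNReal.ofReal_lt_ofReal_iff one_pos).2 hx1

end JointTailBound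

end OneStep

/-! ### Lower bound for the exponent of `R` -/

section LowerBound

variable {Ω : Type*} [MeasurableSpace Ω]

namespace JointTailBound

variable {P : Measure Ω} [IsProbabilityMeasure P] {R M Q : Ω → ℝ} {φ k H : ℝ → ℝ} {r α γ : ℝ}

lemma eventually_lintegral_exp_lt_top (J : JointTailBound P M Q φ k H r α γ) (hM : Measurable M)
    (hQ : Measurable Q) (hR : Measurable R) (hM01 : ∀ᵐ ω ∂P, 0 ≤ M ω ∧ M ω < 1)
    (hQ0 : ∀ᵐ ω ∂P, 0 ≤ Q ω) (hR0 : ∀ᵐ ω ∂P, 0 ≤ R ω) (hgen : IsGeneratedBy P R M Q) :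
    ∀ᶠ x in atTop, ∫⁻ ω, ENNReal.ofReal (Real.exp (γ * (H x / x) * R ω)) ∂P < ⊤ := by
  have hγ := J.one_lt_γ
  filter_upwards [J.eventually_moment_lt_one hM hQ hM01 hQ0 (b := γ) (by linarith)
    one_half_pos one_half_lt_one, J.regVar.pos, eventually_gt_atTop 0]
    with x h1 h2 h3
  exact lintegral_exp_lt_top hM hQ hR hM01 hR0 hgen (by positivity) h1.1

/-- The cumulant generating function of `R` at `z = γ H(x) / x` is asymptotically at most
`(γ - 1)² / γ · H(x)`: its increments between `z(x)` and `z(l x)` are controlled by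
`mul_cgf_sub_le` at `z(l² x)`. -/
lemma cgf_le (J : JointTailBound P M Q φ k H r α γ) (hM : Measurable M)
    (hQ : Measurable Q) (hR : Measurable R) (hM01 : ∀ᵐ ω ∂P, 0 ≤ M ω ∧ M ω < 1)
    (hQ0 : ∀ᵐ ω ∂P, 0 ≤ Q ω) (hR0 : ∀ᵐ ω ∂P, 0 ≤ R ω) (hgen : IsGeneratedBy P R M Q)
    {A : ℝ} (hA : (γ - 1) * (γ - 1) / γ < A) :
    ∃ C, ∀ᶠ x in atTop, cgf R P (γ * (H x / x)) ≤ A * H x + C := by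
  have hγ := J.one_lt_γ
  have hγ1 : 0 < γ - 1 := by linarith
  have hγ0 : 0 < γ := by linarith
  have hA0 : 0 < A := lt_trans (by positivity) hA
  obtain ⟨b, hb1, hb2⟩ := exists_between
    ((lt_div_iff₀ hγ1).2 ((div_lt_iff₀ hγ0).1 hA) : γ - 1 < A * γ / (γ - 1))
  have hb0 : 0 < b := by linarith
  have hbA : b * (γ - 1) / γ < A := by
    rw [lt_div_iff₀ hγ1] at hb2
    rwa [div_lt_iff₀ hγ0]
  obtain ⟨l, hl1, hl⟩ := exists_one_lt_mul_rpow_lt hbA 2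
  rw [Real.rpow_two] at hl
  have hl0 : 0 < l := by linarith
  have hlγ : l < l ^ γ := by
    simpa using Real.rpow_lt_rpow_of_exponent_lt hl1 hγ
  -- `γ (l ^ (γ - 1) - 1) ≤ (γ - 1) (l ^ γ - 1)`
  have hineq : γ * (l ^ γ / l - 1) ≤ (γ - 1) * (l ^ γ - 1) := by
    have h1 := tangent_rpow hγ.le (inv_pos.2 hl0).le
    have h0 : 0 < l ^ γ := by positivity
    rw [Real.inv_rpow hl0.le] at h1
    have h2 := mul_le_mul_of_nonneg_right h1 h0.le
    have h3 : (γ * l⁻¹ - (l ^ γ)⁻¹) * l ^ γ = γ * (l ^ γ / l) - 1 := by field_simp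
    linarith
  have hlim0 : 0 < A * (l ^ γ - 1) - b * l ^ 2 * (l ^ γ / l - 1) := by
    have h1 : b * l ^ 2 * (l ^ γ / l - 1) ≤ b * (γ - 1) / γ * l ^ 2 * (l ^ γ - 1) := by
      have h2 := mul_le_mul_of_nonneg_left hineq (by positivity : 0 ≤ b * l ^ 2 / γ)
      have h3 : b * l ^ 2 / γ * (γ * (l ^ γ / l - 1)) = b * l ^ 2 * (l ^ γ / l - 1) := by
        field_simp
      have h4 : b * l ^ 2 / γ * ((γ - 1) * (l ^ γ - 1)) =
        b * (γ - 1) / γ * l ^ 2 * (l ^ γ - 1) := by ring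
      linarith
    have h2 := mul_lt_mul_of_pos_right hl (by linarith : 0 < l ^ γ - 1)
    linarith
  have hratio : ∀ᶠ x in atTop, 0 < A * (H (l * x) / H x - 1) - b * l ^ 2 *
      (H (l * x) / H x / l - 1) := by
    have h1 := J.regVar.lim l hl0
    exact (((h1.sub_const 1).const_mul A).sub
      (((h1.div_const l).sub_const 1).const_mul (b * l ^ 2))).eventually_const_lt hlim0
  obtain ⟨d, hd1, hd2⟩ := exists_between ((div_lt_one (by positivity)).2 hlγ)
  have hd0 : 0 < d := lt_trans (by positivity) hd1
  have hld : l / d < l ^ γ := by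
    rw [div_lt_iff₀ (by positivity)] at hd1
    rw [div_lt_iff₀ hd0]
    linarith
  have hfin := J.eventually_lintegral_exp_lt_top hM hQ hR hM01 hQ0 hR0 hgen
  set m := l ^ (2 / (γ - 1)) with hm
  have hm0 : 0 < m := by positivity
  have hmγ : l * m < m ^ γ := by
    have h1 : m ^ (γ - 1) = l ^ 2 := by
      rw [hm, ← Real.rpow_mul hl0.le, div_mul_cancel₀ _ hγ1.ne', Real.rpow_two]
    have h2 : m ^ γ = l ^ 2 * m := by
      rw [← h1, ← Real.rpow_add_one hm0.ne', sub_add_cancel]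
    rw [h2]
    have : l < l ^ 2 := by nlinarith
    gcongr
  refine le_of_increment_le hl1 (a := fun x => cgf R P (γ * (H x / x))) ?_ ?_
  · filter_upwards [hratio, J.regVar.pos, eventually_gt_atTop 0,
      J.regVar.eventually_mul_le hl0 hlγ,
      eventually_const_mul (J.regVar.eventually_mul_le hl0 hld) hl0,
      eventually_const_mul hfin (mul_pos hl0 hl0),
      eventually_const_mul (J.eventually_moment_lt_one hM hQ hM01 hQ0 hb1
        (δ := 1 - d) (by linarith) (by linarith)) (mul_pos hl0 hl0)]
      with x h1 hHx hx0 h2 h3 h4 h5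
    rw [← mul_assoc] at h3
    set y := l * l * x with hy
    have hy0 : 0 < y := by positivity
    have hHy : 0 < H y := hHx.trans_le (J.mono (by
      rw [hy]; exact le_mul_of_one_le_left hx0.le (by nlinarith)))
    have hHl : 0 < H (l * x) := lt_of_lt_of_le (by positivity) h2
    have hw12 : γ * (H x / x) ≤ γ * (H (l * x) / (l * x)) := by
      gcongr γ * ?_
      rw [div_le_div_iff₀ hx0 (by positivity)]
      calc H x * (l * x) = l * H x * x := by ring
        _ ≤ H (l * x) * x := by gcongr
    have hwz : γ * (H (l * x) / (l * x)) ≤ (1 - (1 - d)) * (γ * (H y / y)) := by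
      rw [sub_sub_cancel, mul_left_comm]
      gcongr γ * ?_
      rw [div_mul_eq_mul_div, div_le_iff₀ hd0] at h3
      rw [hy, ← mul_div_assoc, div_le_div_iff₀ (by positivity) (by positivity)]
      calc H (l * x) * (l * l * x) = l * H (l * x) * (l * x) := by ring
        _ ≤ H (l * l * x) * d * (l * x) := by gcongr
        _ = _ := by ring
    have hkey : γ * (H y / y) * (cgf R P (γ * (H (l * x) / (l * x))) - cgf R P (γ * (H x / x))) ≤
        b * H y * (γ * (H (l * x) / (l * x)) - γ * (H x / x)) := by
      rcases hw12.eq_or_lt with h | h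
      · rw [h]; simp
      · exact mul_cgf_sub_le hM hQ hR hM01 hR0 hgen (by positivity) (by linarith) h4 h5.2 h hwz
    have h6 : cgf R P (γ * (H (l * x) / (l * x))) - cgf R P (γ * (H x / x)) ≤
        b * l ^ 2 * (H (l * x) / l - H x) := by
      have e1 : b * H y * (γ * (H (l * x) / (l * x)) - γ * (H x / x)) =
          γ * (H y / y) * (b * l ^ 2 * (H (l * x) / l - H x)) := by
        rw [hy]; field_simp
      rw [e1] at hkey
      exact le_of_mul_le_mul_left hkey (by positivity)
    have h7 := mul_pos h1 hHx
    have h8 : (A * (H (l * x) / H x - 1) - b * l ^ 2 * (H (l * x) / H x / l - 1)) * H x =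
        A * (H (l * x) - H x) - b * l ^ 2 * (H (l * x) / l - H x) := by field_simp
    linarith
  · filter_upwards [eventually_const_mul hfin (mul_pos hm0 hl0), eventually_gt_atTop 0,
      eventually_const_mul (J.regVar.eventually_mul_le hm0 hmγ) hl0] with x h1 hx0 h2
    refine ⟨cgf R P (γ * (H (m * l * x) / (m * l * x))), fun y hy => ?_⟩
    have hy0 : 0 < y := hx0.trans_le hy.1
    have h3 : γ * (H y / y) ≤ γ * (H (m * l * x) / (m * l * x)) := by
      gcongr γ * ?_
      have h4 : H y / y ≤ H (l * x) / x := by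
        have := J.nonneg (l * x)
        have := J.mono hy.2
        gcongr
        exact hy.1
      refine h4.trans ?_
      rw [div_le_div_iff₀ hx0 (by positivity)]
      calc H (l * x) * (m * l * x) = l * m * H (l * x) * x := by ring
        _ ≤ H (m * (l * x)) * x := by gcongr
        _ = _ := by rw [mul_assoc]
    have h5 := cgf_mono hR hR0 h3 h1
    have h6 := mul_nonneg hA0.le (J.nonneg y)
    linarith

/-- Chernoff's bound at `z = γ H(x) / x` for the level `y = c x`, where `c = (γ - 1) / γ` is
optimal. -/
theorem log_tail_le (J : JointTailBound P M Q φ k H r α γ) (hM : Measurable M)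
    (hQ : Measurable Q) (hR : Measurable R) (hM01 : ∀ᵐ ω ∂P, 0 ≤ M ω ∧ M ω < 1)
    (hQ0 : ∀ᵐ ω ∂P, 0 ≤ Q ω) (hR0 : ∀ᵐ ω ∂P, 0 ≤ R ω) (hgen : IsGeneratedBy P R M Q)
    (hRpos : ∀ y, 0 < P.real {ω | y < R ω}) {A : ℝ} (hA : A < (γ / (γ - 1)) ^ (γ - 1)) :
    ∀ᶠ y in atTop, Real.log (P.real {ω | y < R ω}) ≤ -(A * H y) := by
  have hγ := J.one_lt_γ
  have hγ1 : 0 < γ - 1 := by linarith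
  have hγ0 : 0 < γ := by linarith
  set c := (γ - 1) / γ with hc
  have hc0 : 0 < c := by positivity
  have hcγ : 0 < c⁻¹ ^ γ := by positivity
  have hcK : (γ / (γ - 1)) ^ (γ - 1) = c * c⁻¹ ^ γ := by
    rw [hc, inv_div, Real.rpow_sub_one (by positivity)]
    field_simp
  rw [hcK] at hA
  obtain ⟨A₁, hA1, hA1'⟩ := exists_between (max_lt hA (by positivity : 0 < c * c⁻¹ ^ γ))
  have hA10 : 0 < A₁ := (le_max_right _ _).trans_lt hA1
  have hAA1 : A < A₁ := (le_max_left _ _).trans_lt hA1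
  obtain ⟨c₁, hc1, hc1'⟩ := exists_between ((div_lt_iff₀ hcγ).2 hA1')
  have hc10 : 0 < c₁ := lt_trans (by positivity) hc1
  -- `c = (γ - 1) - (γ - 1)² / γ`
  have hid : (γ - 1) - (γ - 1) * (γ - 1) / γ = c := by rw [hc]; field_simp; ring
  obtain ⟨C, hC⟩ := J.cgf_le hM hQ hR hM01 hQ0 hR0 hgen
    (by linarith : (γ - 1) * (γ - 1) / γ < (γ - 1) - c₁)
  filter_upwards [eventually_const_mul hC (inv_pos.2 hc0),
    eventually_const_mul (J.eventually_lintegral_exp_lt_top hM hQ hR hM01 hQ0 hR0 hgen)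
      (inv_pos.2 hc0),
    J.regVar.eventually_mul_le (inv_pos.2 hc0) (a := A₁ / c₁)
      (by rw [div_lt_iff₀ hc10]; rw [div_lt_iff₀ hcγ] at hc1; linarith),
    eventually_gt_atTop 0,
    J.tendsto_H.eventually_ge_atTop (C / (A₁ - A))] with y h1 h2 h3 hy h4
  set x := c⁻¹ * y with hx
  have hx0 : 0 < x := by positivity
  have hyx : y = c * x := by rw [hx, mul_inv_cancel_left₀ hc0.ne']
  have hz : 0 ≤ γ * (H x / x) := mul_nonneg hγ0.le (div_nonneg (J.nonneg x) hx0.le)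
  have hch := measure_ge_le_exp_cgf (X := R) (μ := P) y hz (integrable_exp_of_lintegral_lt_top hR h2)
  have h5 : P.real {ω | y < R ω} ≤ P.real {ω | y ≤ R ω} :=
    measureReal_mono fun ω (hω : y < R ω) => hω.le
  have h6 := Real.log_le_log (hRpos y) (h5.trans hch)
  rw [Real.log_exp] at h6
  have h7 : -(γ * (H x / x)) * y = -((γ - 1) * H x) := by rw [hyx, hc]; field_simp
  rw [div_mul_eq_mul_div, div_le_iff₀ hc10] at h3
  rw [div_le_iff₀ (by linarith)] at h4
  linarith

end JointTailBound

end LowerBound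

/-! ### The tails of `M`, `Q` and `R` -/

section Tails

variable {Ω : Type*} [MeasurableSpace Ω] {P : Measure Ω} {R M Q : Ω → ℝ} {α r : ℝ}

lemma measureReal_pos_of_log {A : Set Ω} (h : 0 < -Real.log (P.real A)) : 0 < P.real A := by
  rcases (measureReal_nonneg (μ := P) (s := A)).eq_or_lt with h0 | h0
  · simp [← h0] at h
  · exact h0

variable [IsProbabilityMeasure P]

lemma neg_log_le_neg_log {A B : Set Ω} (hAB : A ⊆ B) (hA : 0 < P.real A) :
    -Real.log (P.real B) ≤ -Real.log (P.real A) :=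
  neg_le_neg (Real.log_le_log hA (measureReal_mono hAB))

lemma measure_eq_ofReal_exp {A : Set Ω} (hA : 0 < P.real A) :
    P A = ENNReal.ofReal (Real.exp (-(-Real.log (P.real A)))) := by
  rw [neg_neg, Real.exp_log hA, ofReal_measureReal]

lemma Q_tail_pos (hk : RegVar (logTail P Q) α) (x : ℝ) : 0 < P.real {ω | x < Q ω} := by
  obtain ⟨y, hy1, hy2⟩ := (hk.pos.and (eventually_ge_atTop x)).exists
  exact (measureReal_pos_of_log hy1).trans_le
    (measureReal_mono fun ω (hω : y < Q ω) => hy2.trans_lt hω)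

lemma M_tail_pos (hf : RegVar (fun x => -Real.log (P.real {ω | 1 - 1 / x ≤ M ω})) (r - 1))
    {t : ℝ} (ht : 0 < t) : 0 < P.real {ω | 1 - 1 / t < M ω} := by
  obtain ⟨y, hy1, hy2⟩ := (hf.pos.and (eventually_gt_atTop t)).exists
  refine (measureReal_pos_of_log hy1).trans_le
    (measureReal_mono fun ω (hω : 1 - 1 / y ≤ M ω) => ?_)
  have : 1 / y < 1 / t := one_div_lt_one_div_of_lt ht hy2
  exact lt_of_lt_of_le (by linarith) hω

/-- The logarithmic tails of `M` near `1` and of `Q` satisfy the standing assumptions on the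
exponents. Replacing `M ≥ 1 - 1/t` by `M > 1 - 1/t` is harmless since the exponents of the two
events interlace. -/
lemma tailExponents (hα : 1 < α) (hr : 1 < r) (hk : RegVar (logTail P Q) α)
    (hf : RegVar (fun x => -Real.log (P.real {ω | 1 - 1 / x ≤ M ω})) (r - 1)) :
    TailExponents (fun t => logTail P M (1 - 1 / t)) (logTail P Q) r α where
  one_lt_r := hr
  one_lt_α := hα
  φ_nonneg t _ := neg_nonneg.2 (Real.log_nonpos measureReal_nonneg measureReal_le_one)
  φ_mono s hs t ht hst := by
    have hs0 : (0 : ℝ) < s := one_pos.trans_le hs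
    refine neg_log_le_neg_log (fun ω (hω : 1 - 1 / t < M ω) => ?_)
      (M_tail_pos hf (one_pos.trans_le ht))
    have : 1 / t ≤ 1 / s := one_div_le_one_div_of_le hs0 hst
    exact lt_of_le_of_lt (by linarith) hω
  φ_regVar := by
    refine hf.of_squeeze ?_ fun c hc => ?_
    · filter_upwards [eventually_gt_atTop 0] with t ht
      exact neg_log_le_neg_log (fun ω (hω : 1 - 1 / t < M ω) => hω.le) (M_tail_pos hf ht)
    · filter_upwards [eventually_gt_atTop 0,
        eventually_const_mul hf.pos (by linarith : 0 < c)] with t ht hct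
      refine neg_log_le_neg_log (fun ω (hω : 1 - 1 / (c * t) ≤ M ω) => ?_)
        (measureReal_pos_of_log hct)
      have : 1 / (c * t) < 1 / t := one_div_lt_one_div_of_lt ht (lt_mul_of_one_lt_left ht hc)
      exact lt_of_lt_of_le (by linarith) hω
  k_nonneg _ := neg_nonneg.2 (Real.log_nonpos measureReal_nonneg measureReal_le_one)
  k_mono x y hxy := neg_log_le_neg_log (fun ω (hω : y < Q ω) => hxy.trans_lt hω) (Q_tail_pos hk y)
  k_regVar := hk

/-- The exponent of `M ≥ 1 - 1/t` tends to infinity, so `M < 1` almost surely. -/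
lemma ae_lt_one (hf : RegVar (fun x => -Real.log (P.real {ω | 1 - 1 / x ≤ M ω})) (r - 1))
    (hE : TailExponents (fun t => logTail P M (1 - 1 / t)) (logTail P Q) r α) :
    ∀ᵐ ω ∂P, M ω < 1 := by
  have hlim : Tendsto (fun t => Real.exp (-logTail P M (1 - 1 / t))) atTop (𝓝 0) :=
    Real.tendsto_exp_neg_atTop_nhds_zero.comp hE.tendsto_φ
  have h0 : P.real {ω | 1 ≤ M ω} ≤ 0 := by
    refine ge_of_tendsto hlim ?_
    filter_upwards [eventually_gt_atTop 0] with t ht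
    rw [logTail, neg_neg, Real.exp_log (M_tail_pos hf ht)]
    refine measureReal_mono fun ω (hω : 1 ≤ M ω) => ?_
    have : 0 < 1 / t := by positivity
    exact lt_of_lt_of_le (by linarith) hω
  have h1 : P {ω | 1 ≤ M ω} = 0 :=
    (measureReal_eq_zero_iff).1 (le_antisymm h0 measureReal_nonneg)
  rw [ae_iff]
  simpa using h1

/-- Inclusion-exclusion: the joint upper tail exceeds the product of the upper tails by exactly as
much as the joint distribution function exceeds the product of the distribution functions. -/
lemma joint_tail_sub (hM : Measurable M) (hQ : Measurable Q) (a b : ℝ) :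
    P.real ({ω | a < M ω} ∩ {ω | b < Q ω}) - P.real {ω | a < M ω} * P.real {ω | b < Q ω} =
      P.real {ω | M ω ≤ a ∧ Q ω ≤ b} - P.real {ω | M ω ≤ a} * P.real {ω | Q ω ≤ b} := by
  have hA : MeasurableSet {ω | a < M ω} := measurableSet_lt measurable_const hM
  have hB : MeasurableSet {ω | b < Q ω} := measurableSet_lt measurable_const hQ
  have e1 : {ω | M ω ≤ a} = {ω | a < M ω}ᶜ := by ext ω; simp
  have e2 : {ω | Q ω ≤ b} = {ω | b < Q ω}ᶜ := by ext ω; simp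
  have e3 : {ω | M ω ≤ a ∧ Q ω ≤ b} = ({ω | a < M ω} ∪ {ω | b < Q ω})ᶜ := by ext ω; simp
  have h := measureReal_union_add_inter (μ := P) (s := {ω | a < M ω}) hB
  rw [e1, e2, e3, probReal_compl_eq_one_sub hA, probReal_compl_eq_one_sub hB,
    probReal_compl_eq_one_sub (hA.union hB)]
  linarith

lemma R_tail_pos (hM0 : ∀ᵐ ω ∂P, 0 ≤ M ω) (hR0 : ∀ᵐ ω ∂P, 0 ≤ R ω)
    (hgen : IsGeneratedBy P R M Q) (hk : RegVar (logTail P Q) α) (y : ℝ) :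
    0 < P.real {ω | y < R ω} := by
  have h1 : P {ω | y < R ω} = P {ω | y < M ω * R ω + Q ω} :=
    hgen.2.measure_mem_eq measurableSet_Ioi
  have h2 : P {ω | y < Q ω} ≤ P {ω | y < M ω * R ω + Q ω} := by
    refine measure_mono_ae ?_
    filter_upwards [hM0, hR0] with ω hm hr (hω : y < Q ω)
    have := mul_nonneg hm hr
    exact lt_of_lt_of_le hω (by linarith)
  rw [measureReal_def, h1]
  exact (Q_tail_pos hk y).trans_le (ENNReal.toReal_mono (measure_ne_top _ _) h2)

/-- One step of the recursion: from `R > z`, `M > 1 - 1/t` and `Q > q` one gets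
`M R + Q > z - z / t + q`. Under positive quadrant dependence this costs at most the sum of the
marginal exponents. -/
lemma neg_log_tail_step (hM : Measurable M) (hQ : Measurable Q)
    (hgen : IsGeneratedBy P R M Q) (hk : RegVar (logTail P Q) α)
    (hf : RegVar (fun x => -Real.log (P.real {ω | 1 - 1 / x ≤ M ω})) (r - 1))
    (hRpos : ∀ y, 0 < P.real {ω | y < R ω}) (hpqd : PosQuadrantDependent P M Q) {z t : ℝ}
    (q : ℝ) (hz : 0 ≤ z) (ht : 1 ≤ t) :
    logTail P R (z - z / t + q) ≤ logTail P R z + (logTail P M (1 - 1 / t) + logTail P Q q) := by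
  have ht0 : 0 < t := by linarith
  set A := {ω | 1 - 1 / t < M ω} ∩ {ω | q < Q ω} with hA
  have hAB : P.real {ω | 1 - 1 / t < M ω} * P.real {ω | q < Q ω} ≤ P.real A := by
    have h1 := joint_tail_sub (P := P) hM hQ (1 - 1 / t) q
    have h2 := hpqd (1 - 1 / t) q
    linarith
  have hind : P.real ({ω | z < R ω} ∩ A) = P.real {ω | z < R ω} * P.real A := by
    have h1 := hgen.1.measure_inter_preimage_eq_mul (Set.Ioi z)
      (Set.Ioi (1 - 1 / t) ×ˢ Set.Ioi q) measurableSet_Ioi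
      (measurableSet_Ioi.prod measurableSet_Ioi)
    have h2 := congrArg ENNReal.toReal h1
    rw [ENNReal.toReal_mul] at h2
    exact h2
  have hsub : P {ω | z - z / t + q < R ω} = P {ω | z - z / t + q < M ω * R ω + Q ω} :=
    hgen.2.measure_mem_eq measurableSet_Ioi
  have hincl : {ω | z < R ω} ∩ A ⊆ {ω | z - z / t + q < M ω * R ω + Q ω} := by
    rintro ω ⟨h1 : z < R ω, h2 : 1 - 1 / t < M ω, h3 : q < Q ω⟩
    have h4 : 0 ≤ 1 - 1 / t := by
      rw [sub_nonneg, div_le_one ht0]; exact ht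
    have h5 : (1 - 1 / t) * z ≤ M ω * R ω :=
      mul_le_mul h2.le h1.le hz (h4.trans h2.le)
    have h6 : (1 - 1 / t) * z = z - z / t := by ring
    show z - z / t + q < M ω * R ω + Q ω
    linarith
  have h7 : P.real {ω | z < R ω} * (P.real {ω | 1 - 1 / t < M ω} * P.real {ω | q < Q ω}) ≤
      P.real {ω | z - z / t + q < R ω} := by
    calc _ ≤ P.real {ω | z < R ω} * P.real A := by gcongr
      _ = P.real ({ω | z < R ω} ∩ A) := hind.symm
      _ ≤ P.real {ω | z - z / t + q < M ω * R ω + Q ω} := measureReal_mono hincl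
      _ = P.real {ω | z - z / t + q < R ω} := by rw [measureReal_def, ← hsub, ← measureReal_def]
  have p1 := hRpos z
  have p2 := M_tail_pos hf ht0
  have p3 := Q_tail_pos hk q
  have h8 := Real.log_le_log (by positivity) h7
  rw [Real.log_mul p1.ne' (by positivity), Real.log_mul p2.ne' p3.ne'] at h8
  simp only [logTail]
  linarith

/-- Under negative quadrant dependence the joint exponent is at least the sum of the marginal
ones. -/
lemma jointTailBound_of_neg (hM : Measurable M) (hQ : Measurable Q)
    (hE : TailExponents (fun t => logTail P M (1 - 1 / t)) (logTail P Q) r α)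
    (hk : RegVar (logTail P Q) α)
    (hf : RegVar (fun x => -Real.log (P.real {ω | 1 - 1 / x ≤ M ω})) (r - 1))
    (hnqd : NegQuadrantDependent P M Q) :
    JointTailBound P M Q (fun t => logTail P M (1 - 1 / t)) (logTail P Q) (hInd P M Q) r α
      (α * r / (α + r - 1)) where
  exponents := hE
  one_lt_γ := hE.one_lt_index
  regVar := hE.infCost_regVar
  mono := hE.infCost_mono
  nonneg := hE.infCost_nonneg
  M_tail _ ht := (measure_eq_ofReal_exp (M_tail_pos hf (one_pos.trans_le ht))).le
  Q_tail q := (measure_eq_ofReal_exp (Q_tail_pos hk q)).le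
  le_cost x _ ht := hE.infCost_le x ht
  joint_tail ε hε _ := by
    refine ⟨0, fun t q ht hq => ?_⟩
    have ht0 : 0 < t := by linarith
    have p2 := M_tail_pos hf ht0
    have p3 := Q_tail_pos hk q
    have h1 := joint_tail_sub (P := P) hM hQ (1 - 1 / t) q
    have h2 := hnqd (1 - 1 / t) q
    rw [← ofReal_measureReal]
    refine ENNReal.ofReal_le_ofReal ((by linarith :
      P.real ({ω | 1 - 1 / t < M ω} ∩ {ω | q < Q ω}) ≤
        P.real {ω | 1 - 1 / t < M ω} * P.real {ω | q < Q ω}).trans ?_)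
    rw [← Real.log_le_log_iff (by positivity) (Real.exp_pos _), Real.log_exp,
      Real.log_mul p2.ne' p3.ne']
    have h3 : hInd P M Q (q * t) ≤ t * logTail P M (1 - 1 / t) + t * logTail P Q (q * t / t) :=
      hE.infCost_le (q * t) ht
    have h4 : 0 ≤ hInd P M Q (q * t) := hE.infCost_nonneg _
    rw [mul_div_cancel_right₀ _ ht0.ne'] at h3
    have h5 : ((1 - ε) * hInd P M Q (q * t) - 0) / t ≤
        logTail P M (1 - 1 / t) + logTail P Q q := by
      rw [div_le_iff₀ ht0]
      nlinarith
    simp only [logTail] at h5 ⊢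
    linarith

/-- Without any assumption on the dependence, the joint exponent is at least the maximum of the
marginal ones. -/
lemma jointTailBound_of_max {u : ℝ} (hu : 0 < u)
    (hE : TailExponents (fun t => logTail P M (1 - 1 / t)) (logTail P Q) r α)
    (hk : RegVar (logTail P Q) α)
    (hf : RegVar (fun x => -Real.log (P.real {ω | 1 - 1 / x ≤ M ω})) (r - 1)) :
    JointTailBound P M Q (fun t => logTail P M (1 - 1 / t)) (logTail P Q)
      (fun x => (u ^ r + u ^ (1 - α))⁻¹ * hInd P M Q x) r α (α * r / (α + r - 1)) := by
  have hr := hE.one_lt_r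
  have hα := hE.one_lt_α
  have h1 : 0 < u ^ r := by positivity
  have h2 : 0 < u ^ (1 - α) := by positivity
  have hD : 1 ≤ u ^ r + u ^ (1 - α) := by
    rcases le_total 1 u with h | h
    · linarith [Real.one_le_rpow h (by linarith : 0 ≤ r)]
    · linarith [Real.one_le_rpow_of_pos_of_le_one_of_nonpos hu h (by linarith : 1 - α ≤ 0)]
  set D := u ^ r + u ^ (1 - α) with hDdef
  have hD0 : 0 < D⁻¹ := by positivity
  exact
  { exponents := hE
    one_lt_γ := hE.one_lt_index
    regVar := hE.infCost_regVar.const_mul hD0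
    mono := hE.infCost_mono.const_mul hD0.le
    nonneg := fun x => mul_nonneg hD0.le (hE.infCost_nonneg x)
    M_tail := fun _ ht => (measure_eq_ofReal_exp (M_tail_pos hf (one_pos.trans_le ht))).le
    Q_tail := fun q => (measure_eq_ofReal_exp (Q_tail_pos hk q)).le
    le_cost := fun x _ ht => (mul_le_of_le_one_left (hE.infCost_nonneg x)
      (inv_le_one_of_one_le₀ hD)).trans (hE.infCost_le x ht)
    joint_tail := by
      intro ε hε hε1
      have hκ : 0 < (1 - ε) * D⁻¹ := mul_pos (by linarith) hD0
      obtain ⟨X, hX⟩ := eventually_atTop.1 (hE.mul_infCost_le_max hu hκ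
        (by rw [← hDdef, inv_mul_cancel_right₀ (by positivity)]; linarith))
      refine ⟨(1 - ε) * D⁻¹ * hInd P M Q X, fun t q ht hq => ?_⟩
      have ht0 : 0 < t := by linarith
      have p2 := M_tail_pos hf ht0
      have p3 := Q_tail_pos hk q
      have hφ : 0 ≤ logTail P M (1 - 1 / t) := hE.φ_nonneg t ht
      have hmax : (1 - ε) * (D⁻¹ * hInd P M Q (q * t)) - (1 - ε) * D⁻¹ * hInd P M Q X ≤
          max (logTail P M (1 - 1 / t)) (logTail P Q q) * t := by
        rcases le_total X (q * t) with h | h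
        · have h3 := hX _ h t ht
          rw [mul_div_cancel_right₀ _ ht0.ne', ← mul_max_of_nonneg _ _ ht0.le] at h3
          have h4 : 0 ≤ (1 - ε) * D⁻¹ * hInd P M Q X :=
            mul_nonneg hκ.le (hE.infCost_nonneg X)
          have h5 : (1 - ε) * D⁻¹ * hInd P M Q (q * t) ≤
            t * max (logTail P M (1 - 1 / t)) (logTail P Q q) := h3
          linarith
        · have h3 : (1 - ε) * D⁻¹ * hInd P M Q (q * t) ≤ (1 - ε) * D⁻¹ * hInd P M Q X :=
            mul_le_mul_of_nonneg_left (hE.infCost_mono h) hκ.le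
          have h4 := mul_nonneg (hφ.trans (le_max_left _ (logTail P Q q))) ht0.le
          linarith
      rw [← div_le_iff₀ ht0] at hmax
      set B := ((1 - ε) * (D⁻¹ * hInd P M Q (q * t)) - (1 - ε) * D⁻¹ * hInd P M Q X) / t
      rcases le_max_iff.1 hmax with h | h
      · refine (measure_mono Set.inter_subset_left).trans
          ((measure_eq_ofReal_exp p2).le.trans (ENNReal.ofReal_le_ofReal (Real.exp_le_exp.2 ?_)))
        exact neg_le_neg h
      · refine (measure_mono Set.inter_subset_right).trans
          ((measure_eq_ofReal_exp p3).le.trans (ENNReal.ofReal_le_ofReal (Real.exp_le_exp.2 ?_)))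
        exact neg_le_neg h }

end Tails

/-! ### Limits of the ratio -/

lemma limsup_coe_le {f : ℝ → ℝ} {a : ℝ} (h : ∀ b, a < b → ∀ᶠ x in atTop, f x ≤ b) :
    limsup (fun x => (f x : EReal)) atTop ≤ (a : EReal) := by
  refine EReal.le_of_forall_lt_iff_le.1 fun b hb => limsup_le_of_le (by isBoundedDefault) ?_
  filter_upwards [h b (EReal.coe_lt_coe_iff.1 hb)] with x hx
  exact EReal.coe_le_coe_iff.2 hx

lemma le_liminf_coe {f : ℝ → ℝ} {a : ℝ} (h : ∀ b, b < a → ∀ᶠ x in atTop, b ≤ f x) :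
    (a : EReal) ≤ liminf (fun x => (f x : EReal)) atTop := by
  refine EReal.ge_of_forall_gt_iff_ge.1 fun b hb => le_liminf_of_le (by isBoundedDefault) ?_
  filter_upwards [h b (EReal.coe_lt_coe_iff.1 hb)] with x hx
  exact EReal.coe_le_coe_iff.2 hx

/-- The factor lost in `TailExponents.mul_infCost_le_max`, at its minimizing `u`. -/
lemma inv_rpow_add_rpow {α r : ℝ} (hα : 1 < α) (hr : 1 < r) :
    ((((α - 1) / r) ^ (1 / (α + r - 1))) ^ r +
      (((α - 1) / r) ^ (1 / (α + r - 1))) ^ (1 - α))⁻¹ =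
      (α - 1) / (α + r - 1) * (r / (α - 1)) ^ (r / (α + r - 1)) := by
  have hα1 : 0 < α - 1 := by linarith
  have hr0 : 0 < r := by linarith
  have hd : 0 < α + r - 1 := by linarith
  set v := (α - 1) / r with hv
  have hv0 : 0 < v := by positivity
  have e1 : (v ^ (1 / (α + r - 1))) ^ r = v ^ (r / (α + r - 1)) := by
    rw [← Real.rpow_mul hv0.le]; congr 1; ring
  have e2 : (v ^ (1 / (α + r - 1))) ^ (1 - α) = v ^ (r / (α + r - 1)) / v := by
    rw [← Real.rpow_mul hv0.le, ← Real.rpow_sub_one hv0.ne']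
    congr 1
    field_simp
    ring
  have e3 : (r / (α - 1)) ^ (r / (α + r - 1)) = (v ^ (r / (α + r - 1)))⁻¹ := by
    rw [← Real.inv_rpow hv0.le, hv, inv_div]
  have hp : 0 < v ^ (r / (α + r - 1)) := by positivity
  rw [e1, e2, e3]
  set w := v ^ (r / (α + r - 1))
  rw [hv]
  field_simp
  ring

end Perpetuity

open Perpetuity in
theorem theorem5p2 {Ω : Type*} [MeasurableSpace Ω] (P : Measure Ω) [IsProbabilityMeasure P]
    (M Q R : Ω → ℝ) (hM : Measurable M) (hQ : Measurable Q) (hR : Measurable R)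
    (hMQpos : ∀ᵐ ω ∂P, 0 ≤ M ω ∧ 0 ≤ Q ω)
    (hgen : Perpetuity.IsGeneratedBy P R M Q)
    (α r β rstar γ : ℝ) (hα : 1 < α) (hr : 1 < r)
    (hk : Perpetuity.IsRegularlyVarying (fun x => -Real.log (P.real {ω | x < Q ω})) α)
    (hf : Perpetuity.IsRegularlyVarying
      (fun x => -x * Real.log (P.real {ω | 1 - 1 / x ≤ M ω})) r)
    (hβ : α.HolderConjugate β) (hrstar : r.HolderConjugate rstar)
    (hγ : γ = β * rstar / (β * rstar - 1)) :
    (Perpetuity.NegQuadrantDependent P M Q →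
      limsup (Perpetuity.tailRatio P R M Q) atTop
        ≤ ((-(γ / (γ - 1)) ^ (γ - 1) : ℝ) : EReal)) ∧
    (Perpetuity.PosQuadrantDependent P M Q →
      ((-(γ / (γ - 1)) ^ (γ - 1) : ℝ) : EReal)
        ≤ liminf (Perpetuity.tailRatio P R M Q) atTop ∧
      liminf (Perpetuity.tailRatio P R M Q) atTop
        ≤ limsup (Perpetuity.tailRatio P R M Q) atTop ∧
      limsup (Perpetuity.tailRatio P R M Q) atTop
        ≤ ((-((α - 1) / (α + r - 1) * (r / (α - 1)) ^ (r / (α + r - 1))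
            * (γ / (γ - 1)) ^ (γ - 1)) : ℝ) : EReal)) := by
  have hα1 : 0 < α - 1 := by linarith
  have hr1 : 0 < r - 1 := by linarith
  have hγ' : γ = α * r / (α + r - 1) := by
    have e : α / (α - 1) * (r / (r - 1)) - 1 = (α + r - 1) / ((α - 1) * (r - 1)) := by
      field_simp
      ring
    rw [hγ, hβ.conjugate_eq, hrstar.conjugate_eq, e]
    have : α + r - 1 ≠ 0 := by linarith
    field_simp
  have hk' : RegVar (logTail P Q) α := hk.regVar
  have hf' : RegVar (fun x => -Real.log (P.real {ω | 1 - 1 / x ≤ M ω})) (r - 1) := by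
    refine RegVar.of_id_mul ?_
    convert hf.regVar using 2
    ring
  have hE : TailExponents (fun t => logTail P M (1 - 1 / t)) (logTail P Q) r α :=
    tailExponents hα hr hk' hf'
  have hM0 : ∀ᵐ ω ∂P, 0 ≤ M ω := hMQpos.mono fun ω h => h.1
  have hQ0 : ∀ᵐ ω ∂P, 0 ≤ Q ω := hMQpos.mono fun ω h => h.2
  have hM01 : ∀ᵐ ω ∂P, 0 ≤ M ω ∧ M ω < 1 := hM0.and (ae_lt_one hf' hE)
  have hR0 : ∀ᵐ ω ∂P, 0 ≤ R ω := ae_nonneg hM hQ hR hM01 hQ0 hgen.2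
  have hRpos := R_tail_pos hM0 hR0 hgen hk'
  have hpos : ∀ᶠ x in atTop, 0 < hInd P M Q x := hE.infCost_pos
  subst hγ'
  set γ := α * r / (α + r - 1) with hγdef
  refine ⟨fun hnqd => ?_, fun hpqd => ⟨?_, liminf_le_limsup (by isBoundedDefault)
    (by isBoundedDefault), ?_⟩⟩
  · refine limsup_coe_le fun b hb => ?_
    filter_upwards [hpos, (jointTailBound_of_neg hM hQ hE hk' hf' hnqd).log_tail_le hM hQ hR hM01
      hQ0 hR0 hgen hRpos (A := -b) (by linarith)] with x h1 h2
    rw [div_le_iff₀ h1]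
    linarith
  · refine le_liminf_coe fun b hb => ?_
    have hstep : ∀ z t q, 0 ≤ z → 1 ≤ t → 0 ≤ q → logTail P R (z - z / t + q) ≤
        logTail P R z + (logTail P M (1 - 1 / t) + logTail P Q q) :=
      fun z t q hz ht _ => neg_log_tail_step hM hQ hgen hk' hf' hRpos hpqd q hz ht
    have hG : Monotone (logTail P R) := fun x y hxy =>
      neg_log_le_neg_log (fun ω (hω : y < R ω) => hxy.trans_lt hω) (hRpos y)
    filter_upwards [hpos, hE.exponent_le hγdef hG hstep (A := -b) (by linarith)] with x h1 h2
    rw [le_div_iff₀ h1]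
    have h3 : -Real.log (P.real {ω | x < R ω}) ≤ -b * hInd P M Q x := h2
    linarith
  · refine limsup_coe_le fun b hb => ?_
    rw [← inv_rpow_add_rpow hα hr] at hb
    have hu : 0 < ((α - 1) / r) ^ (1 / (α + r - 1)) := by positivity
    set u := ((α - 1) / r) ^ (1 / (α + r - 1))
    have hD : 0 < u ^ r + u ^ (1 - α) := by positivity
    set D := u ^ r + u ^ (1 - α) with hDdef
    have hbD : -b * D < (γ / (γ - 1)) ^ (γ - 1) := by
      rw [← lt_div_iff₀ hD, div_eq_inv_mul]
      linarith
    filter_upwards [hpos, (jointTailBound_of_max hu hE hk' hf').log_tail_le hM hQ hR hM01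
      hQ0 hR0 hgen hRpos hbD] with x h1 h2
    rw [div_le_iff₀ h1]
    have h3 : -b * D * (D⁻¹ * hInd P M Q x) = -b * hInd P M Q x := by field_simp
    rw [← hDdef, h3] at h2
    linarith
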